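/- **Proposition.** Let $\mathcal X,\mathcal Y,\mathcal Z$ be finite alphabets, $P_{YZ|X}$ a discrete memoryless wiretap channel with marginals $P_{Y|X},P_{Z|X}$, $Q_Z$ a distribution on $\mathcal Z$, and $s\in[-1,1]$. All logarithms are natural. For distributions $P,Q$ on a finite alphabet, $D_{1+s}(P\|Q)=\frac1s\log\sum_{x:P(x)>0}P(x)^{1+s}Q(x)^{-s}\in[0,\infty]$ for $s\neq0$, and $D_1=D$ is the relative entropy. For rates $R_0,R_1\ge 0$, let $(M_0,M_1)$ be uniform on $\{1,\dots,\lceil e^{nR_0}\rceil\}\times\{1,\dots,\lceil e^{nR_1}\rceil\}$. An $(n,R_0,R_1)$ secrecy code consists of a stochastic encoder $P_{X^n|M_0M_1}$ and a stochastic decoder $P_{\widehat M_0\widehat M_1|Y^n}$; $(Y^n,Z^n)$ is the output of $n$ uses of the channel with input $X^n$. The pair $(R_0,R_1)$ is $(Q_Z,1+s)$-achievable if there is a sequence of $(n,R_0,R_1)$ secrecy codes with $$\lim_{n\to\infty}\mathbb P\big((M_0,M_1)\ne(\widehat M_0,\widehat M_1)\big)=0,\qquad \lim_{n\to\infty}D_{1+s}\big(P_{M_1Z^n}\,\|\,P_{M_1}Q_Z^{n}\big)=0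 .$$ Let $\mathcal R_{1+s}(Q_Z)\subseteq\mathbb R^2$ be the closure of the set of $(Q_Z,1+s)$-achievable pairs. For a finite alphabet $\mathcal W$, a channel $P_{X|W}$ and a distribution $P_W$, let $P_{Y|W}$ and $P_{Z|W}$ be the cascades of $P_{X|W}$ with $P_{Y|X}$ and $P_{Z|X}$, let $I(W;Y)$ be the mutual information under $P_WP_{Y|W}$, and put (with $0\cdot\infty=0$) $$\widetilde R_{1+s}(P_W,P_{Z|W},Q_Z)=\begin{cases}\sum_wP_W(w)\,D_{1+s}\big(P_{Z|W}(\cdot|w)\|Q_Z\big), & s\in(0,1],\\ \sum_wP_W(w)\,D\big(P_{Z|W}(\cdot|w)\|Q_Z\big), & s\in(-1,0],\\ 0,& s=-1.\end{cases}$$ Then $$\mathcal R_{1+s}(Q_Z)\ \supseteq\ \bigcup_{P_{X|W},\,P_W}\Big\{(R_0,R_1): R_0,R_1\ge0,\ R_0+R_1\le I(W;Y),\ R_0\ge\widetilde R_{1+s}(P_W,P_{Z|W},Q_Z)\Big\},$$ where the union is over all finite alphabets $\mathcal W$, all $P_{X|W}$, and all $P_W$ with $\sum_wP_W(w)P_{Z|W}(\cdot|w)=Q_Z$,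 except the degenerate choices with $\widetilde R_{1+s}(P_W,P_{Z|W},Q_Z)=I(W;Y)>0$ (for which the set in braces is the single point $(I(W;Y),0)$). -/

import Mathlib

open Filter Topology
open scoped ENNReal

noncomputable section

namespace Wiretap

/-- The Renyi divergence `D_{1+s}(P ‖ Q)` of order `1 + s` (natural logarithm) between two
distributions on a finite alphabet, with values in the extended reals.  For `s = 0` it is the
relative entropy, equal to `⊤` unless `P ≪ Q`.  For `s ≠ 0` it is
`(1 / s) log ∑ P(x)^{1+s} Q(x)^{-s}`, the sum being over the support of `P`; so it is `⊤` when
`s > 0` and `P` is not absolutely continuous with respect to `Q`, it is `⊤` when `s < 0` and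
`P`, `Q` are mutually singular, and for `s = -1` it is `- log Q(P > 0)`. -/
def renyiDiv {α : Type*} [Fintype α] (s : ℝ) (P Q : PMF α) : EReal :=
  open Classical in
  if s = 0 then
    if ∀ x, Q x = 0 → P x = 0 then
      ((∑ x, (P x).toReal * Real.log ((P x).toReal / (Q x).toReal) : ℝ) : EReal)
    else ⊤
  else
    ((1 / s : ℝ) : EReal) *
      ENNReal.log (∑ x, if P x = 0 then 0 else P x ^ (1 + s) * Q x ^ (-s))

/-- The relative entropy `D(P ‖ Q)`. -/
def relEntropy {α : Type*} [Fintype α] (P Q : PMF α) : EReal := renyiDiv 0 P Q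

/-- The joint distribution `P_A P_{B|A}` on `A × B`. -/
def joint {A B : Type*} (P : PMF A) (V : A → PMF B) : PMF (A × B) :=
  P.bind fun a => (V a).map fun b => (a, b)

/-- The product distribution `P × Q` on `A × B`. -/
def indep {A B : Type*} (P : PMF A) (Q : PMF B) : PMF (A × B) := joint P fun _ => Q

/-- The mutual information `I(A;B)` for `(A,B) ~ P_A P_{B|A}`. -/
def mutualInfo {A B : Type*} [Fintype A] [Fintype B] (P : PMF A) (V : A → PMF B) : EReal :=
  relEntropy (joint P V) (indep P (P.bind V))

/-- The set of the input distributions `P_A` with `P_{B|A} ∘ P_A = Q_B`. -/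
def inputsInducing {A B : Type*} (V : A → PMF B) (Q : PMF B) : Set (PMF A) :=
  {P | P.bind V = Q}

/-- The product of the distributions `P_1, …, P_n` on a finite alphabet. -/
def prodDist {B : Type*} [Fintype B] {n : ℕ} (P : Fin n → PMF B) : PMF (Fin n → B) :=
  PMF.ofFintype (fun b => ∏ i, P i (b i)) <| by
    classical
    have h : ∀ i, ∑ b, P i b = 1 := fun i => by
      rw [← tsum_fintype (L := .unconditional B)]; exact (P i).tsum_coe
    rw [← Fintype.prod_sum]
    simp [h]

/-- The marginal channel to the legitimate user. -/
def chanY {X Y Z : Type*} (P : X → PMF (Y × Z)) (x : X) : PMF Y := (P x).map Prod.fst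

/-- The marginal channel to the wiretapper. -/
def chanZ {X Y Z : Type*} (P : X → PMF (Y × Z)) (x : X) : PMF Z := (P x).map Prod.snd

/-- The cascade of a channel `P_{X|W}` with a channel `P_{B|X}`. -/
def cascade {W X B : Type*} (V : W → PMF X) (P : X → PMF B) (w : W) : PMF B := (V w).bind P

/-- The number of messages at rate `R` and blocklength `n`: `e^{nR}`, rounded up. -/
def msgCount (n : ℕ) (R : ℝ) : ℕ := ⌈Real.exp (n * R)⌉₊

instance instNeZeroMsgCount (n : ℕ) (R : ℝ) : NeZero (msgCount n R) :=
  ⟨(Nat.ceil_pos.mpr (Real.exp_pos _)).ne'⟩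

/-- The set of the message pairs `(m₀, m₁)`. -/
abbrev Msg (n : ℕ) (R₀ R₁ : ℝ) : Type := Fin (msgCount n R₀) × Fin (msgCount n R₁)

/-- An `(n, R₀, R₁)` secrecy code: a stochastic encoder and a stochastic decoder. -/
structure SecrecyCode (X Y : Type*) (n : ℕ) (R₀ R₁ : ℝ) where
  enc : Msg n R₀ R₁ → PMF (Fin n → X)
  dec : (Fin n → Y) → PMF (Msg n R₀ R₁)

section code

variable {X Y Z : Type*} [Fintype Y] [Fintype Z] {n : ℕ} {R₀ R₁ : ℝ}

/-- The joint law of `((M₀, M₁), Zⁿ, (M̂₀, M̂₁))` induced by a code: the messages are uniform,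
`Xⁿ` is drawn by the encoder, `(Yⁿ, Zⁿ)` is the output of `n` uses of the memoryless channel, and
the message estimate is drawn by the decoder from `Yⁿ`. -/
def SecrecyCode.law (c : SecrecyCode X Y n R₀ R₁) (P : X → PMF (Y × Z)) :
    PMF (Msg n R₀ R₁ × (Fin n → Z) × Msg n R₀ R₁) :=
  (PMF.uniformOfFintype (Msg n R₀ R₁)).bind fun m =>
    (c.enc m).bind fun x =>
      (prodDist fun i => P (x i)).bind fun yz =>
        (c.dec fun i => (yz i).1).map fun m' => (m, (fun i => (yz i).2), m')

/-- The probability that `(M₀, M₁) ≠ (M̂₀, M̂₁)`. -/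
def SecrecyCode.errorProb (c : SecrecyCode X Y n R₀ R₁) (P : X → PMF (Y × Z)) : ℝ≥0∞ :=
  (c.law P).toOuterMeasure {ω | ω.1 ≠ ω.2.2}

/-- The leakage `D_{1+s}(P_{M₁Zⁿ} ‖ P_{M₁} Q_Zⁿ)`. -/
def SecrecyCode.leakage (c : SecrecyCode X Y n R₀ R₁) (P : X → PMF (Y × Z)) (Q : PMF Z)
    (s : ℝ) : EReal :=
  renyiDiv s ((c.law P).map fun ω => (ω.1.2, ω.2.1))
    (indep (PMF.uniformOfFintype (Fin (msgCount n R₁))) (prodDist fun _ : Fin n => Q))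

end code

section region

variable {X Y Z : Type*} [Fintype Y] [Fintype Z]

/-- `(R₀, R₁)` is `(Q_Z, 1+s)`-achievable. -/
def IsAchievable (P : X → PMF (Y × Z)) (Q : PMF Z) (s R₀ R₁ : ℝ) : Prop :=
  0 ≤ R₀ ∧ 0 ≤ R₁ ∧ ∃ c : ∀ n : ℕ, SecrecyCode X Y n R₀ R₁,
    Tendsto (fun n => (c n).errorProb P) atTop (𝓝 0) ∧
    Tendsto (fun n => (c n).leakage P Q s) atTop (𝓝 0)

/-- The `(Q_Z, 1+s)`-admissible region. -/
def admissibleRegion (P : X → PMF (Y × Z)) (Q : PMF Z) (s : ℝ) : Set (ℝ × ℝ) :=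
  closure {p | IsAchievable P Q s p.1 p.2}

/-- The quantity `R̃_{1+s}(P_W, P_{Z|W}, Q_Z)`. -/
def rTilde {W : Type*} [Fintype W] (s : ℝ) (PW : PMF W) (V : W → PMF Z) (Q : PMF Z) : EReal :=
  open Classical in
  if 0 < s then ∑ w, (PW w : EReal) * renyiDiv s (V w) Q
  else if -1 < s then ∑ w, (PW w : EReal) * relEntropy (V w) Q
  else 0

/-- The rate pairs allowed by a virtual channel `P_{X|W} = V` and an input `P_W`. -/
def ratePairs {W : Type*} [Fintype W] (P : X → PMF (Y × Z)) (Q : PMF Z) (s : ℝ)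
    (V : W → PMF X) (PW : PMF W) : Set (ℝ × ℝ) :=
  {p | 0 ≤ p.1 ∧ 0 ≤ p.2 ∧
    ((p.1 + p.2 : ℝ) : EReal) ≤ mutualInfo PW (cascade V (chanY P)) ∧
    rTilde s PW (cascade V (chanZ P)) Q ≤ (p.1 : EReal)}

/-- The pair `(P_{X|W}, P_W)` is degenerate when `R̃_{1+s} = I(W;Y) > 0`; its set of rate pairs is
then the single point `(I(W;Y), 0)`. -/
def IsDegenerate {W : Type*} [Fintype W] (P : X → PMF (Y × Z)) (Q : PMF Z) (s : ℝ)
    (V : W → PMF X) (PW : PMF W) : Prop :=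
  rTilde s PW (cascade V (chanZ P)) Q = mutualInfo PW (cascade V (chanY P)) ∧
    0 < mutualInfo PW (cascade V (chanY P))

/-- The union of the rate pairs over all finite alphabets `W`, all virtual channels `P_{X|W}` and
all `P_W` that induce `Q_Z`, the degenerate pairs `(P_{X|W}, P_W)` being left out. -/
def virtualChannelRegion (P : X → PMF (Y × Z)) (Q : PMF Z) (s : ℝ) : Set (ℝ × ℝ) :=
  ⋃ (k : ℕ) (V : Fin k → PMF X) (PW : PMF (Fin k))
    (_ : PW ∈ inputsInducing (cascade V (chanZ P)) Q) (_ : ¬ IsDegenerate P Q s V PW),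
    ratePairs P Q s V PW

end region

end Wiretap

end

open Filter Topology
open scoped ENNReal

namespace Wiretap

/-! Random coding. A codeword is drawn independently for every pair `(m₀, m₁)`. Decoding the pair
from the legitimate output needs `R₀ + R₁ < I(W;Y)`. For each fixed `m₁`, the codewords indexed by
`m₀` must make the wiretapper's output resemble `Q^n` (soft covering). With `G(w) = ∑ z,
P_{Z|W}(z|w)^(1+s) Q(z)^(-s)` and `s` in `(0,1]`, codewords drawn from `P_W^n` would need `s R₀ >
log E[G(W)]`, which by Jensen is in general more than the claimed `s R₀ > E[log G(W)]`. The remedy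
is to condition `P_W^n` on the event that `∑ i, log (G (w i))` is at most `n` times slightly more
than its mean. By the weak law this event has probability `α → 1`, and every codeword now obeys the
bound, so the exponent becomes `E[log G(W)]`, while conditioning costs only powers of `α`.

`piE_threshold_error_le` and `piE_soft_covering_le` bound the two averages, and `exists_codebook`
extracts one codebook good for both: the sum of error probability and power sum is at most `1 +
o(1)` on average, and the two terms are at least `0` and `1`.

For `s` in `(-1,0]` the argument runs at an order `1 + t` slightly above `1`; as `t → 0` the
requirement on `R₀` tends to the mean relative entropy (`exists_order_sum_log_lt`), and a vanishing
leakage at order `1 + t` forces it to vanish at all orders in `(0,1]`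
(`tendsto_renyiDiv_of_power_sum_le`). For `s = -1` only supports matter, so any reliable code works
once its encoder sends, with small probability, an i.i.d. word that induces `Q^n`.

Strict inequalities extend to the stated region by closure: a nondegenerate choice with `I(W;Y) > 0`
leaves room to approach every pair from inside, and when `I(W;Y) = 0` only the pair `(0,0)` remains.
-/

/-! ### Expectations under product weights -/

/-- The expectation of `F` under the product weights `∏ i, p (c i)`. -/
noncomputable def piE {ι A : Type*} [Fintype ι] [DecidableEq ι] [Fintype A] (p : A → ℝ)
    (F : (ι → A) → ℝ) : ℝ :=
  ∑ c, (∏ i, p (c i)) * F c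

section piE

variable {ι A : Type*} [Fintype ι] [DecidableEq ι] [Fintype A] {p : A → ℝ}

theorem piE_add (F G : (ι → A) → ℝ) : piE p (fun c => F c + G c) = piE p F + piE p G := by
  simp only [piE, mul_add, Finset.sum_add_distrib]

theorem piE_mul_left (r : ℝ) (F : (ι → A) → ℝ) : piE p (fun c => r * F c) = r * piE p F := by
  simp only [piE, Finset.mul_sum]
  exact Finset.sum_congr rfl fun _ _ => by ring

theorem piE_sum {κ : Type*} (t : Finset κ) (F : κ → (ι → A) → ℝ) :
    piE p (fun c => ∑ k ∈ t, F k c) = ∑ k ∈ t, piE p (F k) := by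
  simp only [piE, Finset.mul_sum]
  exact Finset.sum_comm

theorem piE_mono (hp : ∀ a, 0 ≤ p a) {F G : (ι → A) → ℝ}
    (h : ∀ c, (∀ i, 0 < p (c i)) → F c ≤ G c) : piE p F ≤ piE p G := by
  refine Finset.sum_le_sum fun c _ => ?_
  by_cases hc : ∀ i, 0 < p (c i)
  · exact mul_le_mul_of_nonneg_left (h c hc) (Finset.prod_nonneg fun i _ => hp _)
  · push Not at hc
    obtain ⟨i, hi⟩ := hc
    have : ∏ i, p (c i) = 0 := Finset.prod_eq_zero (Finset.mem_univ i) (le_antisymm hi (hp _))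
    simp [this]

theorem piE_mul_eq_prod (f : ι → A → ℝ) :
    piE p (fun c => ∏ i, f i (c i)) = ∏ i, ∑ a, p a * f i a := by
  rw [Fintype.prod_sum]
  exact Finset.sum_congr rfl fun c _ => by rw [Finset.prod_mul_distrib]

theorem piE_const (h1 : ∑ a, p a = 1) (r : ℝ) : piE p (fun _ : ι → A => r) = r := by
  have h := piE_mul_eq_prod (p := p) (ι := ι) (fun _ _ => 1)
  have h2 := piE_mul_left (p := p) (ι := ι) r (fun _ => 1)
  simp only [Finset.prod_const_one, mul_one, h1] at h h2
  rw [h2, h, mul_one]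

theorem piE_single (h1 : ∑ a, p a = 1) (i : ι) (f : A → ℝ) :
    piE p (fun c => f (c i)) = ∑ a, p a * f a := by
  have h := piE_mul_eq_prod (p := p) (fun j a => if j = i then f a else 1)
  simp only [Finset.prod_ite_eq', Finset.mem_univ, if_true] at h
  rw [h, ← Finset.mul_prod_erase _ _ (Finset.mem_univ i), Finset.prod_eq_one, mul_one]
  · simp
  · intro j hj
    simp [Finset.ne_of_mem_erase hj, h1]

theorem piE_pair (h1 : ∑ a, p a = 1) {i j : ι} (hij : i ≠ j) (f g : A → ℝ) :
    piE p (fun c => f (c i) * g (c j)) = (∑ a, p a * f a) * ∑ a, p a * g a := by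
  have h := piE_mul_eq_prod (p := p)
    (fun k a => (if k = i then f a else 1) * (if k = j then g a else 1))
  simp only [Finset.prod_mul_distrib, Finset.prod_ite_eq', Finset.mem_univ, if_true] at h
  rw [h, ← Finset.mul_prod_erase _ _ (Finset.mem_univ i),
    ← Finset.mul_prod_erase _ _ (Finset.mem_erase.2 ⟨hij.symm, Finset.mem_univ j⟩),
    Finset.prod_eq_one, mul_one]
  · simp [hij, hij.symm]
  · intro k hk
    have hkj := Finset.ne_of_mem_erase hk
    have hki := Finset.ne_of_mem_erase (Finset.mem_of_mem_erase hk)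
    simp [hki, hkj, h1]

/-- First-moment method. The positivity of the letters is kept because absolute continuity with
respect to the target output is known only for letters of positive weight. -/
theorem exists_le_of_piE_le (hp : ∀ a, 0 ≤ p a) (h1 : ∑ a, p a = 1) {F : (ι → A) → ℝ} {r : ℝ}
    (h : piE p F ≤ r) : ∃ c, (∀ i, 0 < p (c i)) ∧ F c ≤ r := by
  by_contra! hne
  have hone : ∑ c : ι → A, ∏ i, p (c i) = 1 := by
    simpa [piE] using piE_const (ι := ι) h1 1
  obtain ⟨c, -, hc⟩ : ∃ c ∈ Finset.univ, (0 : ℝ) < ∏ i, p ((c : ι → A) i) := by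
    by_contra! hall
    have := Finset.sum_nonpos hall
    linarith
  have hpos : ∀ {c : ι → A}, 0 < ∏ i, p (c i) → ∀ i, 0 < p (c i) := fun {c} hc i =>
    lt_of_le_of_ne (hp _) fun h0 =>
      hc.ne' (Finset.prod_eq_zero (Finset.mem_univ i) h0.symm)
  have : piE p (fun _ : ι → A => r) < piE p F := by
    refine Finset.sum_lt_sum (fun c _ => ?_) ⟨c, Finset.mem_univ c, ?_⟩
    · rcases (Finset.prod_nonneg fun i (_ : i ∈ Finset.univ) => hp (c i)).eq_or_lt' with h0 | h0
      · simp [h0]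
      · exact mul_le_mul_of_nonneg_left (hne c (hpos h0)).le h0.le
    · exact mul_lt_mul_of_pos_left (hne c (hpos hc)) hc
  rw [piE_const h1] at this
  linarith

end piE

/-! ### The weak law of large numbers -/

theorem piE_sum_sq {A : Type*} [Fintype A] {p : A → ℝ} (h1 : ∑ a, p a = 1) {f : A → ℝ}
    (hf : ∑ a, p a * f a = 0) (n : ℕ) :
    piE p (fun c : Fin n → A => (∑ i, f (c i)) ^ 2) = n * ∑ a, p a * f a ^ 2 := by
  have : (fun c : Fin n → A => (∑ i, f (c i)) ^ 2) = fun c => ∑ i, ∑ j, f (c i) * f (c j) := by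
    funext c
    rw [sq, Finset.sum_mul_sum]
  rw [this, piE_sum]
  have key : ∀ i : Fin n,
      piE p (fun c : Fin n → A => ∑ j, f (c i) * f (c j)) = ∑ a, p a * f a ^ 2 := by
    intro i
    rw [piE_sum, Finset.sum_eq_single i]
    · rw [piE_single h1 i (fun a => f a * f a)]
      simp only [sq]
    · intro j _ hj
      rw [piE_pair h1 hj.symm, hf, zero_mul]
    · simp
  simp [key]

open Classical in
-- Chebyshev's inequality, with the variance of the sum supplied by `piE_sum_sq`.
theorem piE_lower_tail_le {A : Type*} [Fintype A] {p : A → ℝ} (hp : ∀ a, 0 ≤ p a)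
    (h1 : ∑ a, p a = 1) (f : A → ℝ) {ε : ℝ} (hε : 0 < ε) {n : ℕ} (hn : 0 < n) :
    piE p (fun c : Fin n → A =>
      if ∑ i, f (c i) < n * ((∑ a, p a * f a) - ε) then (1 : ℝ) else 0) ≤
      (∑ a, p a * (f a - ∑ a, p a * f a) ^ 2) / ε ^ 2 / n := by
  set μ := ∑ a, p a * f a with hμ
  have hn' : (0 : ℝ) < n := by exact_mod_cast hn
  have h0 : ∑ a, p a * (f a - μ) = 0 := by
    simp only [mul_sub, Finset.sum_sub_distrib, ← Finset.sum_mul, h1, one_mul, ← hμ, sub_self]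
  have hle : piE p (fun c : Fin n → A =>
      if ∑ i, f (c i) < n * (μ - ε) then (1 : ℝ) else 0) ≤
      piE p (fun c : Fin n → A => (1 / (n * ε) ^ 2) * (∑ i, (f (c i) - μ)) ^ 2) := by
    refine piE_mono hp fun c _ => ?_
    split_ifs with h
    · have h2 : ∑ i, (f (c i) - μ) ≤ -(n * ε) := by
        simp only [Finset.sum_sub_distrib, Finset.sum_const, Finset.card_univ, Fintype.card_fin,
          nsmul_eq_mul]
        nlinarith
      have h3 : (n * ε) ^ 2 ≤ (∑ i, (f (c i) - μ)) ^ 2 := by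
        have : 0 < n * ε := by positivity
        nlinarith
      rw [div_mul_eq_mul_div, one_mul, le_div_iff₀ (by positivity)]
      linarith
    · positivity
  refine hle.trans (le_of_eq ?_)
  rw [piE_mul_left, piE_sum_sq h1 h0]
  field_simp

open Classical in
theorem tendsto_piE_lower_tail {A : Type*} [Fintype A] {p : A → ℝ} (hp : ∀ a, 0 ≤ p a)
    (h1 : ∑ a, p a = 1) (f : A → ℝ) {ε : ℝ} (hε : 0 < ε) :
    Tendsto (fun n : ℕ => piE p (fun c : Fin n → A =>
      if ∑ i, f (c i) < n * ((∑ a, p a * f a) - ε) then (1 : ℝ) else 0)) atTop (𝓝 0) := by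
  refine squeeze_zero' (.of_forall fun n => ?_) ?_
    (tendsto_const_div_atTop_nhds_zero_nat
      ((∑ a, p a * (f a - ∑ a, p a * f a) ^ 2) / ε ^ 2))
  · exact Finset.sum_nonneg fun c _ => mul_nonneg (Finset.prod_nonneg fun i _ => hp _)
      (by dsimp only; split_ifs <;> norm_num)
  · filter_upwards [eventually_gt_atTop 0] with n hn
    exact piE_lower_tail_le hp h1 f hε hn

/-! ### Random codebooks: decoding -/

open Classical in
-- A union bound: the sent codeword fails the test, or some other one passes it. A competing
-- codeword is independent of the sent one, hence of the output, so its term factors. The letters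
-- `a` will later be whole codewords under the conditioned law.
theorem piE_threshold_error_le {A B M : Type*} [Fintype A] [Fintype B] [Fintype M]
    [DecidableEq M] [Nonempty M] {p : A → ℝ} (hp : ∀ a, 0 ≤ p a) (h1 : ∑ a, p a = 1)
    {V : A → B → ℝ} (hV : ∀ a b, 0 ≤ V a b) (good : A → B → Prop) :
    piE p (fun c : M → A => (Fintype.card M : ℝ)⁻¹ * ∑ m, ∑ b, V (c m) b *
      ((if good (c m) b then 0 else 1) +
        ∑ k ∈ Finset.univ.erase m, if good (c k) b then (1 : ℝ) else 0)) ≤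
      (∑ a, p a * ∑ b, V a b * if good a b then 0 else 1) +
      Fintype.card M * ∑ b, (∑ a, p a * V a b) * ∑ a, p a * if good a b then 1 else 0 := by
  have hM : (0 : ℝ) < Fintype.card M := by exact_mod_cast Fintype.card_pos
  rw [piE_mul_left, piE_sum]
  have key : ∀ m : M, piE p (fun c : M → A => ∑ b, V (c m) b *
      ((if good (c m) b then 0 else 1) +
        ∑ k ∈ Finset.univ.erase m, if good (c k) b then (1 : ℝ) else 0)) ≤
      (∑ a, p a * ∑ b, V a b * if good a b then 0 else 1) +
      Fintype.card M * ∑ b, (∑ a, p a * V a b) * ∑ a, p a * if good a b then 1 else 0 := by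
    intro m
    simp only [mul_add, Finset.sum_add_distrib, Finset.mul_sum (s := Finset.univ.erase m)]
    rw [piE_add, piE_single h1 m (fun a => ∑ b, V a b * if good a b then 0 else 1), piE_sum,
      Finset.mul_sum]
    gcongr with b _
    rw [piE_sum]
    calc ∑ k ∈ Finset.univ.erase m,
          piE p (fun c : M → A => V (c m) b * if good (c k) b then (1 : ℝ) else 0)
        = ∑ k ∈ Finset.univ.erase m,
          (∑ a, p a * V a b) * ∑ a, p a * if good a b then 1 else 0 := by
          refine Finset.sum_congr rfl fun k hk => ?_
          exact piE_pair h1 (Finset.ne_of_mem_erase hk).symm (fun a => V a b)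
            (fun a => if good a b then (1 : ℝ) else 0)
      _ ≤ _ := by
          rw [Finset.sum_const, nsmul_eq_mul]
          refine mul_le_mul_of_nonneg_right ?_ ?_
          · exact_mod_cast Finset.card_le_univ _
          · refine mul_nonneg (Finset.sum_nonneg fun a _ => mul_nonneg (hp a) (hV a b))
              (Finset.sum_nonneg fun a _ => mul_nonneg (hp a) ?_)
            split_ifs <;> norm_num
  calc _ ≤ (Fintype.card M : ℝ)⁻¹ * ∑ _m : M,
        ((∑ a, p a * ∑ b, V a b * if good a b then 0 else 1) +
        Fintype.card M * ∑ b, (∑ a, p a * V a b) * ∑ a, p a * if good a b then 1 else 0) := by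
        gcongr with m _
        exact key m
    _ = _ := by
        rw [Finset.sum_const, Finset.card_univ, nsmul_eq_mul, inv_mul_cancel_left₀ hM.ne']

open Classical in
/-- A decoder that picks a message whose codeword passes the test errs only if the true codeword
fails the test or another one passes it. -/
theorem exists_threshold_decoder {B M : Type*} [Fintype M] [DecidableEq M] [Nonempty M]
    (good : M → B → Prop) : ∃ D : B → M, ∀ m b, (if D b = m then (0 : ℝ) else 1) ≤
      (if good m b then 0 else 1) + ∑ k ∈ Finset.univ.erase m, if good k b then (1 : ℝ) else 0 := by
  refine ⟨fun b => if h : ∃ m, good m b then h.choose else Classical.arbitrary M, fun m b => ?_⟩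
  have hnn : ∀ k, (0 : ℝ) ≤ if good k b then (1 : ℝ) else 0 := fun k => by split_ifs <;> norm_num
  have hs := Finset.sum_nonneg fun k (_ : k ∈ Finset.univ.erase m) => hnn k
  by_cases hm : good m b
  · have h : ∃ m, good m b := ⟨m, hm⟩
    simp only [h, dif_pos, hm, if_true, zero_add]
    split_ifs with he
    · exact hs
    · have := Finset.single_le_sum (fun k (_ : k ∈ Finset.univ.erase m) => hnn k)
        (Finset.mem_erase.2 ⟨he, Finset.mem_univ _⟩)
      rwa [if_pos h.choose_spec] at this
  · simp only [hm, if_false]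
    split_ifs <;> linarith

/-! ### Random codebooks: soft covering -/

/-- Jensen for the concave map `r ↦ r ^ s`, in the form of its tangent at the mean `T`: `S ^ s ≤ T ^
(s - 1) * (s * S + (1 - s) * T)`. This bound is linear in `S`, so independence of `c l` from each
single `c k` suffices. The case `T = 0` is separate because the tangent degenerates there. -/
theorem piE_mul_rpow_le {A M : Type*} [Fintype A] [Fintype M] [DecidableEq M]
    {p : A → ℝ} (hp : ∀ a, 0 ≤ p a) (h1 : ∑ a, p a = 1) {h : A → ℝ} (hh : ∀ a, 0 ≤ h a)
    {s : ℝ} (hs : s ∈ Set.Ioc (0 : ℝ) 1) (l : M) {t : Finset M} (hlt : l ∉ t) {L : ℝ}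
    (hL : 0 < L) (htL : (t.card : ℝ) ≤ L) :
    piE p (fun c : M → A => h (c l) * ((∑ k ∈ t, h (c k)) / L) ^ s) ≤
      (∑ a, p a * h a) ^ (1 + s) := by
  set T := ∑ a, p a * h a with hT
  have hT0 : 0 ≤ T := Finset.sum_nonneg fun a _ => mul_nonneg (hp a) (hh a)
  rcases hT0.eq_or_lt with h0 | hTpos
  · have hz : ∀ a, p a * h a = 0 := fun a =>
      (Finset.sum_eq_zero_iff_of_nonneg fun a _ => mul_nonneg (hp a) (hh a)).1 h0.symm a
        (Finset.mem_univ a)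
    have : piE p (fun c : M → A => h (c l) * ((∑ k ∈ t, h (c k)) / L) ^ s) ≤
        piE p (fun _ : M → A => 0) := piE_mono hp fun c hc => by
      have : h (c l) = 0 := (mul_eq_zero.1 (hz (c l))).resolve_left (hc l).ne'
      simp [this]
    rw [piE_const h1] at this
    exact this.trans (Real.rpow_nonneg hT0 _)
  · have hpt : ∀ c : M → A, h (c l) * ((∑ k ∈ t, h (c k)) / L) ^ s ≤
        T ^ (s - 1) * ((s / L) * ∑ k ∈ t, h (c l) * h (c k) + ((1 - s) * T) * h (c l)) := by
      intro c
      set S := (∑ k ∈ t, h (c k)) / L with hS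
      have hS0 : 0 ≤ S := div_nonneg (Finset.sum_nonneg fun k _ => hh _) hL.le
      have am := Real.geom_mean_le_arith_mean2_weighted hs.1.le (sub_nonneg.2 hs.2) hS0 hT0
        (by ring : s + (1 - s) = 1)
      have e : T ^ (s - 1) * T ^ (1 - s) = 1 := by
        rw [← Real.rpow_add hTpos]; simp
      have hk : S ^ s ≤ T ^ (s - 1) * (s * S + (1 - s) * T) := by
        calc S ^ s = T ^ (s - 1) * (S ^ s * T ^ (1 - s)) := by
              rw [mul_left_comm, e, mul_one]
          _ ≤ _ := mul_le_mul_of_nonneg_left am (Real.rpow_nonneg hT0 _)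
      calc h (c l) * S ^ s ≤ h (c l) * (T ^ (s - 1) * (s * S + (1 - s) * T)) :=
            mul_le_mul_of_nonneg_left hk (hh _)
        _ = _ := by
            rw [hS, ← Finset.mul_sum]
            field_simp
    refine (piE_mono hp fun c _ => hpt c).trans ?_
    rw [piE_mul_left, piE_add, piE_mul_left, piE_mul_left, piE_sum, piE_single h1, ← hT]
    have : ∀ k ∈ t, piE p (fun c : M → A => h (c l) * h (c k)) = T * T := fun k hk => by
      exact piE_pair h1 (ne_of_mem_of_not_mem hk hlt).symm h h
    rw [Finset.sum_congr rfl this, Finset.sum_const, nsmul_eq_mul]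
    have e2 : T ^ (1 + s) = T ^ (s - 1) * (T * T) := by
      rw [← sq, ← Real.rpow_natCast, ← Real.rpow_add hTpos]
      congr 1
      push_cast
      ring
    rw [e2]
    refine mul_le_mul_of_nonneg_left ?_ (Real.rpow_nonneg hT0 _)
    have : s / L * (t.card * (T * T)) ≤ s * (T * T) := by
      rw [div_mul_eq_mul_div, div_le_iff₀ hL]
      have := mul_le_mul_of_nonneg_right htL (mul_nonneg hs.1.le (mul_self_nonneg T))
      nlinarith [this]
    nlinarith [this]

/-- With `x` the average, `x ^ (1 + s)` is `∑ (h l / L) * x ^ s`; subadditivity of `r ↦ r ^ s`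
separates the term `l` itself from the others, which are independent of it in a random codebook. -/
theorem rpow_one_add_sum_le {M : Type*} [DecidableEq M] (t : Finset M) {h : M → ℝ}
    (hh : ∀ m, 0 ≤ h m) {s : ℝ} (hs : s ∈ Set.Ioc (0 : ℝ) 1) {L : ℝ} (hL : 0 < L) :
    ((∑ l ∈ t, h l) / L) ^ (1 + s) ≤
      ∑ l ∈ t, (L ^ (-s) / L * h l ^ (1 + s) +
        (1 / L) * (h l * ((∑ k ∈ t.erase l, h k) / L) ^ s)) := by
  have h0 : 0 ≤ (∑ l ∈ t, h l) / L := div_nonneg (Finset.sum_nonneg fun m _ => hh m) hL.le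
  rw [Real.rpow_add_of_nonneg h0 zero_le_one hs.1.le, Real.rpow_one]
  conv_lhs => rw [Finset.sum_div, Finset.sum_mul]
  refine Finset.sum_le_sum fun l hl => ?_
  have e : (∑ k ∈ t, h k) / L = h l / L + (∑ k ∈ t.erase l, h k) / L := by
    rw [← Finset.add_sum_erase _ _ hl, add_div]
  have hb : 0 ≤ (∑ k ∈ t.erase l, h k) / L :=
    div_nonneg (Finset.sum_nonneg fun m _ => hh m) hL.le
  have ha : 0 ≤ h l / L := div_nonneg (hh l) hL.le
  have sub := Real.rpow_add_le_add_rpow ha hb hs.1.le hs.2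
  rw [← Finset.sum_div, e]
  refine (mul_le_mul_of_nonneg_left sub ha).trans (le_of_eq ?_)
  rw [Real.div_rpow (hh l) hL.le, Real.rpow_neg hL.le,
    Real.rpow_add_of_nonneg (hh l) zero_le_one hs.1.le, Real.rpow_one]
  field_simp

/-- The first term on the right is the price of using finitely many codewords and decays with their
number. The second is the power sum of the averaged output, equal to `1` when that output is `q`. -/
theorem piE_soft_covering_le {A B M₀ M₁ : Type*} [Fintype A] [Fintype B] [Fintype M₀] [Fintype M₁]
    [DecidableEq M₀] [DecidableEq M₁] [Nonempty M₀] [Nonempty M₁]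
    {p : A → ℝ} (hp : ∀ a, 0 ≤ p a) (h1 : ∑ a, p a = 1)
    {V : A → B → ℝ} (hV : ∀ a b, 0 ≤ V a b) {q : B → ℝ} (hq : ∀ b, 0 ≤ q b)
    {s : ℝ} (hs : s ∈ Set.Ioc (0 : ℝ) 1) :
    piE p (fun c : M₀ × M₁ → A => (Fintype.card M₁ : ℝ)⁻¹ * ∑ m₁, ∑ b,
      ((∑ m₀, V (c (m₀, m₁)) b) / Fintype.card M₀) ^ (1 + s) * q b ^ (-s)) ≤
      (Fintype.card M₀ : ℝ) ^ (-s) * (∑ a, p a * ∑ b, V a b ^ (1 + s) * q b ^ (-s)) +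
      ∑ b, (∑ a, p a * V a b) ^ (1 + s) * q b ^ (-s) := by
  have hM₁ : (0 : ℝ) < Fintype.card M₁ := by exact_mod_cast Fintype.card_pos
  have hL : (0 : ℝ) < Fintype.card M₀ := by exact_mod_cast Fintype.card_pos
  set L : ℝ := (Fintype.card M₀ : ℝ) with hLdef
  rw [piE_mul_left, piE_sum]
  have key : ∀ (m₁ : M₁) (b : B), piE p (fun c : M₀ × M₁ → A =>
      q b ^ (-s) * ((∑ m₀, V (c (m₀, m₁)) b) / L) ^ (1 + s)) ≤
      q b ^ (-s) *
        (L ^ (-s) * (∑ a, p a * V a b ^ (1 + s)) + (∑ a, p a * V a b) ^ (1 + s)) := by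
    intro m₁ b
    rw [piE_mul_left]
    refine mul_le_mul_of_nonneg_left ?_ (Real.rpow_nonneg (hq b) _)
    refine (piE_mono hp fun c _ =>
      rpow_one_add_sum_le Finset.univ (fun m₀ => hV (c (m₀, m₁)) b) hs hL).trans ?_
    rw [piE_sum]
    have hl : ∀ l : M₀, piE p (fun c : M₀ × M₁ → A => L ^ (-s) / L * V (c (l, m₁)) b ^ (1 + s) +
        1 / L * (V (c (l, m₁)) b *
          ((∑ k ∈ Finset.univ.erase l, V (c (k, m₁)) b) / L) ^ s)) ≤
        1 / L * (L ^ (-s) * (∑ a, p a * V a b ^ (1 + s)) + (∑ a, p a * V a b) ^ (1 + s)) := by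
      intro l
      rw [piE_add, piE_mul_left, piE_mul_left, piE_single h1 (l, m₁) (fun a => V a b ^ (1 + s)),
        mul_add]
      refine add_le_add (le_of_eq (by ring)) (mul_le_mul_of_nonneg_left ?_ (by positivity))
      have := piE_mul_rpow_le (M := M₀ × M₁) hp h1 (h := fun a => V a b) (fun a => hV a b) hs
        -- Only the codewords sharing `m₁` interact: `t` is the slice `M₀ × {m₁}` without `(l, m₁)`.
        (l, m₁) (t := (Finset.univ.erase l).map (Function.Embedding.sectL M₀ m₁))
        (by simp) hL (by
          rw [Finset.card_map, hLdef]
          exact_mod_cast Finset.card_le_univ _)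
      simpa only [Finset.sum_map, Function.Embedding.sectL_apply] using this
    refine (Finset.sum_le_sum fun l _ => hl l).trans (le_of_eq ?_)
    rw [Finset.sum_const, Finset.card_univ, nsmul_eq_mul, ← hLdef]
    field_simp
  have key' : ∀ m₁ : M₁, piE p (fun c : M₀ × M₁ → A => ∑ b,
      ((∑ m₀, V (c (m₀, m₁)) b) / L) ^ (1 + s) * q b ^ (-s)) ≤
      L ^ (-s) * (∑ a, p a * ∑ b, V a b ^ (1 + s) * q b ^ (-s)) +
      ∑ b, (∑ a, p a * V a b) ^ (1 + s) * q b ^ (-s) := by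
    intro m₁
    rw [piE_sum]
    simp only [mul_comm _ (q _ ^ (-s))]
    refine (Finset.sum_le_sum fun b _ => key m₁ b).trans (le_of_eq ?_)
    simp only [mul_add, Finset.sum_add_distrib, Finset.mul_sum]
    congr 1
    rw [Finset.sum_comm]
    exact Finset.sum_congr rfl fun a _ => Finset.sum_congr rfl fun b _ => by ring
  calc _ ≤ (Fintype.card M₁ : ℝ)⁻¹ * ∑ _m : M₁, _ :=
        mul_le_mul_of_nonneg_left (Finset.sum_le_sum fun m₁ _ => key' m₁) (by positivity)
    _ = _ := by
        rw [Finset.sum_const, Finset.card_univ, nsmul_eq_mul, inv_mul_cancel_left₀ hM₁.ne']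

/-! ### Pointwise bounds for power sums -/

theorem add_mul_log_le_rpow_mul_rpow {P q : ℝ} (hP : 0 < P) (hq : 0 < q) (s : ℝ) :
    P + s * (P * Real.log (P / q)) ≤ P ^ (1 + s) * q ^ (-s) := by
  have e : P ^ (1 + s) * q ^ (-s) = P * Real.exp (s * Real.log (P / q)) := by
    rw [Real.rpow_add hP, Real.rpow_one, Real.rpow_neg hq.le, mul_assoc, ← div_eq_mul_inv,
      ← Real.div_rpow hP.le hq.le, Real.rpow_def_of_pos (div_pos hP hq), mul_comm s]
  rw [e]
  nlinarith [Real.add_one_le_exp (s * Real.log (P / q))]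

theorem sub_le_mul_log {P q : ℝ} (hP : 0 < P) (hq : 0 < q) :
    P - q ≤ P * Real.log (P / q) := by
  have h := Real.one_sub_inv_le_log_of_pos (div_pos hP hq)
  rw [inv_div] at h
  calc P - q = P * (1 - q / P) := by field_simp
    _ ≤ _ := mul_le_mul_of_nonneg_left h hP.le

section powerSum

variable {α : Type*} [Fintype α] {P q : α → ℝ}

/-- This is `1 + x ≤ exp x` at `x = s * log (P / q)`, averaged over `P`. It serves both signs of
`s`: for `s > 0` a power sum near `1` forces a small relative entropy, and for `s < 0` a small
relative entropy keeps the power sum from falling far below `1`. -/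
theorem one_add_mul_sum_log_le (hP : ∀ x, 0 ≤ P x) (hq : ∀ x, 0 ≤ q x) (hP1 : ∑ x, P x = 1)
    (hac : ∀ x, q x = 0 → P x = 0) (s : ℝ) :
    1 + s * ∑ x, P x * Real.log (P x / q x) ≤ ∑ x, P x ^ (1 + s) * q x ^ (-s) := by
  have e : 1 + s * ∑ x, P x * Real.log (P x / q x) =
      ∑ x, (P x + s * (P x * Real.log (P x / q x))) := by
    rw [Finset.sum_add_distrib, hP1, Finset.mul_sum]
  rw [e]
  refine Finset.sum_le_sum fun x _ => ?_
  rcases (hP x).eq_or_lt with h | h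
  · rw [← h]
    simpa using mul_nonneg (Real.rpow_nonneg le_rfl _) (Real.rpow_nonneg (hq x) _)
  · exact add_mul_log_le_rpow_mul_rpow h
      (lt_of_le_of_ne (hq x) fun h0 => h.ne' (hac x h0.symm)) s

theorem sum_mul_log_nonneg (hP : ∀ x, 0 ≤ P x) (hq : ∀ x, 0 ≤ q x) (hP1 : ∑ x, P x = 1)
    (hq1 : ∑ x, q x = 1) (hac : ∀ x, q x = 0 → P x = 0) :
    0 ≤ ∑ x, P x * Real.log (P x / q x) := by
  have : ∑ x, (P x - q x) ≤ ∑ x, P x * Real.log (P x / q x) := by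
    refine Finset.sum_le_sum fun x _ => ?_
    rcases (hP x).eq_or_lt with h | h
    · rw [← h]
      simpa using hq x
    · exact sub_le_mul_log h (lt_of_le_of_ne (hq x) fun h0 => h.ne' (hac x h0.symm))
  rwa [Finset.sum_sub_distrib, hP1, hq1, sub_self] at this

theorem one_le_sum_rpow (hP : ∀ x, 0 ≤ P x) (hq : ∀ x, 0 ≤ q x) (hP1 : ∑ x, P x = 1)
    (hq1 : ∑ x, q x = 1) (hac : ∀ x, q x = 0 → P x = 0) {s : ℝ} (hs : 0 ≤ s) :
    1 ≤ ∑ x, P x ^ (1 + s) * q x ^ (-s) := by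
  have h1 := one_add_mul_sum_log_le hP hq hP1 hac s
  have h2 := mul_nonneg hs (sum_mul_log_nonneg hP hq hP1 hq1 hac)
  linarith

theorem sum_rpow_le_one (hP : ∀ x, 0 ≤ P x) (hq : ∀ x, 0 ≤ q x) (hP1 : ∑ x, P x = 1)
    (hq1 : ∑ x, q x = 1) {s : ℝ} (hs : s ∈ Set.Icc (-1) 0) :
    ∑ x, P x ^ (1 + s) * q x ^ (-s) ≤ 1 := by
  have : ∑ x, P x ^ (1 + s) * q x ^ (-s) ≤ ∑ x, ((1 + s) * P x + (-s) * q x) :=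
    Finset.sum_le_sum fun x _ => Real.geom_mean_le_arith_mean2_weighted
      (by linarith [hs.1]) (by linarith [hs.2]) (hP x) (hq x) (by ring)
  rw [Finset.sum_add_distrib, ← Finset.mul_sum, ← Finset.mul_sum, hP1, hq1] at this
  linarith

end powerSum

/-! ### Random codebooks drawn from a conditioned product distribution -/

theorem sum_prod_channel {n : ℕ} {A B : Type*} [Fintype B] {V : A → B → ℝ}
    (h : ∀ a, ∑ b, V a b = 1) (w : Fin n → A) : ∑ y : Fin n → B, ∏ i, V (w i) (y i) = 1 := by
  rw [← Fintype.prod_sum]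
  simp [h]

theorem sum_prod_mul_prod_channel {n : ℕ} {A B : Type*} [Fintype A] [Fintype B] {p : A → ℝ}
    {V : A → B → ℝ} (y : Fin n → B) :
    ∑ w : Fin n → A, (∏ i, p (w i)) * ∏ i, V (w i) (y i) = ∏ i, ∑ a, p a * V a (y i) := by
  rw [Fintype.prod_sum]
  exact Finset.sum_congr rfl fun w _ => Finset.prod_mul_distrib.symm

theorem piE_prod_eq {n : ℕ} {A B : Type*} [Fintype A] [Fintype B] {p : A → ℝ} {V : A → B → ℝ}
    (F : (Fin n → A) → (Fin n → B) → ℝ) :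
    piE (fun ab : A × B => p ab.1 * V ab.1 ab.2) (fun c : Fin n → A × B =>
      F (fun i => (c i).1) fun i => (c i).2) =
    ∑ w : Fin n → A, (∏ i, p (w i)) * ∑ y : Fin n → B, (∏ i, V (w i) (y i)) * F w y := by
  simp only [Finset.mul_sum]
  rw [← Fintype.sum_prod_type', piE]
  refine Fintype.sum_equiv (Equiv.arrowProdEquivProdArrow (Fin n) (fun _ => A) fun _ => B) _ _
    fun c => ?_
  simp only [Equiv.arrowProdEquivProdArrow_apply, Finset.prod_mul_distrib, mul_assoc]

open Classical in
/-- Random coding with codewords drawn from the product distribution conditioned on an event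
`∑ i, g (w i) ≤ κ`: some codebook and decoder are good for both receivers. -/
theorem exists_codebook {A B C M₀ M₁ : Type*} [Fintype A] [Fintype B] [Fintype C]
    [Fintype M₀] [Fintype M₁] [DecidableEq M₀] [DecidableEq M₁] [Nonempty M₀] [Nonempty M₁]
    {p : A → ℝ} (hp : ∀ a, 0 ≤ p a) (hp1 : ∑ a, p a = 1)
    {V : A → B → ℝ} (hV : ∀ a b, 0 ≤ V a b) (hV1 : ∀ a, ∑ b, V a b = 1)
    {U : A → C → ℝ} (hU : ∀ a c, 0 ≤ U a c) (hU1 : ∀ a, ∑ c, U a c = 1)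
    {q : C → ℝ} (hq : ∀ c, ∑ a, p a * U a c = q c) {s : ℝ} (hs : s ∈ Set.Ioc (0 : ℝ) 1)
    {n : ℕ} {κ γ α τ : ℝ} (hα : 0 < α)
    (hαdef : α = piE p (fun w : Fin n → A =>
      if ∑ i, Real.log (∑ c, U (w i) c ^ (1 + s) * q c ^ (-s)) ≤ κ then (1 : ℝ) else 0))
    (hτ : τ = piE (fun ab : A × B => p ab.1 * V ab.1 ab.2) (fun c : Fin n → A × B =>
      if ∑ i, Real.log (V (c i).1 (c i).2 / ∑ a, p a * V a (c i).2) < γ then (1 : ℝ) else 0)) :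
    ∃ (c : M₀ × M₁ → Fin n → A) (D : (Fin n → B) → M₀ × M₁), (∀ m i, 0 < p (c m i)) ∧
      (Fintype.card (M₀ × M₁) : ℝ)⁻¹ * ∑ m, ∑ y : Fin n → B,
        (∏ i, V (c m i) (y i)) * (if D y = m then 0 else 1) ≤
        τ / α + Fintype.card (M₀ × M₁) * Real.exp (-γ) / α ^ 2 +
          (Fintype.card M₀ : ℝ) ^ (-s) * Real.exp κ + (α ^ (-s) - 1) ∧
      (Fintype.card M₁ : ℝ)⁻¹ * ∑ m₁, ∑ z : Fin n → C,
        ((∑ m₀, ∏ i, U (c (m₀, m₁) i) (z i)) / Fintype.card M₀) ^ (1 + s) *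
          (∏ i, q (z i)) ^ (-s) ≤
        1 + (τ / α + Fintype.card (M₀ × M₁) * Real.exp (-γ) / α ^ 2 +
          (Fintype.card M₀ : ℝ) ^ (-s) * Real.exp κ + (α ^ (-s) - 1)) := by
  have hq0 : ∀ c, 0 ≤ q c := fun c => hq c ▸ Finset.sum_nonneg fun a _ => mul_nonneg (hp a) (hU a c)
  have hac : ∀ a, 0 < p a → ∀ c, q c = 0 → U a c = 0 := fun a ha c hc => by
    rw [← hq, Finset.sum_eq_zero_iff_of_nonneg fun a _ => mul_nonneg (hp a) (hU a c)] at hc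
    exact (mul_eq_zero.1 (hc a (Finset.mem_univ a))).resolve_left ha.ne'
  have hq1 : ∑ c, q c = 1 := by
    simp only [← hq]
    rw [Finset.sum_comm]
    simp only [← Finset.mul_sum, hU1, mul_one, hp1]
  set G : A → ℝ := fun a => ∑ c, U a c ^ (1 + s) * q c ^ (-s) with hG
  have hG1 : ∀ a, 0 < p a → 1 ≤ G a := fun a ha =>
    one_le_sum_rpow (hU a) hq0 (hU1 a) hq1 (hac a ha) hs.1.le
  set pY : B → ℝ := fun b => ∑ a, p a * V a b
  set pn : (Fin n → A) → ℝ := fun w => ∏ i, p (w i) with hpn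
  set Vn : (Fin n → A) → (Fin n → B) → ℝ := fun w y => ∏ i, V (w i) (y i)
  set Un : (Fin n → A) → (Fin n → C) → ℝ := fun w z => ∏ i, U (w i) (z i)
  set qn : (Fin n → C) → ℝ := fun z => ∏ i, q (z i) with hqn
  -- The product law conditioned on the event of probability `α`. Afterwards only `pt ≤ pn / α` and
  -- the bound on the support are used.
  set pt : (Fin n → A) → ℝ := fun w =>
    pn w * ((if ∑ i, Real.log (G (w i)) ≤ κ then (1 : ℝ) else 0) / α) with hpt
  have hpn0 : ∀ w, 0 ≤ pn w := fun w => Finset.prod_nonneg fun i _ => hp _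
  have hVn0 : ∀ w y, 0 ≤ Vn w y := fun w y => Finset.prod_nonneg fun i _ => hV _ _
  have hUn0 : ∀ w z, 0 ≤ Un w z := fun w z => Finset.prod_nonneg fun i _ => hU _ _
  have hqn0 : ∀ z, 0 ≤ qn z := fun z => Finset.prod_nonneg fun i _ => hq0 _
  have hpt0 : ∀ w, 0 ≤ pt w := fun w => mul_nonneg (hpn0 w)
    (div_nonneg (by split_ifs <;> norm_num) hα.le)
  have hpt1 : ∑ w, pt w = 1 := by
    simp only [hpt, ← mul_div_assoc, ← Finset.sum_div]
    rw [div_eq_one_iff_eq hα.ne', hαdef]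
    rfl
  have hptle : ∀ w, pt w ≤ pn w / α := fun w => by
    rw [div_eq_mul_one_div]
    refine mul_le_mul_of_nonneg_left ?_ (hpn0 w)
    gcongr
    split_ifs <;> norm_num
  have hsupp : ∀ w, 0 < pt w → (∀ i, 0 < p (w i)) ∧ ∑ i, Real.log (G (w i)) ≤ κ := by
    intro w hw
    constructor
    · intro i
      refine lt_of_le_of_ne (hp _) fun h => hw.ne' ?_
      have : pn w = 0 := Finset.prod_eq_zero (Finset.mem_univ i) h.symm
      simp [hpt, this]
    · by_contra h
      exact hw.ne' (by simp [hpt, h])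
  have hmarg : ∀ y, ∑ w, pn w * Vn w y = ∏ i, pY (y i) := fun y => sum_prod_mul_prod_channel y
  have hmargU : ∀ z, ∑ w, pn w * Un w z = qn z := fun z => by
    rw [sum_prod_mul_prod_channel z]
    simp only [hq, hqn]
  -- Positivity of all transition probabilities belongs to the test because `Real.log 0 = 0`: an
  -- impossible letter would otherwise go unpenalised.
  obtain ⟨good, hgood⟩ : ∃ good : (Fin n → A) → (Fin n → B) → Prop, ∀ w y, good w y ↔
      (∀ i, 0 < V (w i) (y i)) ∧ γ ≤ ∑ i, Real.log (V (w i) (y i) / pY (y i)) :=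
    ⟨_, fun _ _ => Iff.rfl⟩
  -- the error probability
  have herr1 : (∑ w, pt w * ∑ y, Vn w y * if good w y then (0 : ℝ) else 1) ≤ τ / α := by
    have h1 : τ = ∑ w, pn w * ∑ y, Vn w y *
        (if ∑ i, Real.log (V (w i) (y i) / pY (y i)) < γ then (1 : ℝ) else 0) := by
      rw [hτ]
      exact piE_prod_eq (fun w y =>
        if ∑ i, Real.log (V (w i) (y i) / pY (y i)) < γ then (1 : ℝ) else 0)
    rw [h1, Finset.sum_div]
    refine Finset.sum_le_sum fun w _ => ?_
    have h2 : ∀ y, Vn w y * (if good w y then (0 : ℝ) else 1) ≤ Vn w y *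
        (if ∑ i, Real.log (V (w i) (y i) / pY (y i)) < γ then (1 : ℝ) else 0) := by
      intro y
      by_cases hpos : ∀ i, 0 < V (w i) (y i)
      · refine mul_le_mul_of_nonneg_left (le_of_eq ?_) (hVn0 w y)
        simp only [hgood, hpos, implies_true, true_and, ← not_lt, ite_not]
      · push Not at hpos
        obtain ⟨i, hi⟩ := hpos
        have : Vn w y = 0 :=
          Finset.prod_eq_zero (Finset.mem_univ i) (le_antisymm hi (hV _ _))
        simp [this]
    calc _ ≤ pn w / α * ∑ y, Vn w y *
          (if ∑ i, Real.log (V (w i) (y i) / pY (y i)) < γ then (1 : ℝ) else 0) := by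
          refine mul_le_mul (hptle w) (Finset.sum_le_sum fun y _ => h2 y) ?_
            (div_nonneg (hpn0 w) hα.le)
          exact Finset.sum_nonneg fun y _ => mul_nonneg (hVn0 w y) (by split_ifs <;> norm_num)
      _ = _ := by ring
  -- Change of measure: passing the test means `∏ pY ≤ exp (-γ) * Vn`, and `Vn` sums to `1`. Each of
  -- the two conditioned codewords contributes a factor `1 / α`.
  have herr2 : ∑ y, (∑ w, pt w * Vn w y) * ∑ w, pt w * (if good w y then (1 : ℝ) else 0) ≤
      Real.exp (-γ) / α ^ 2 := by
    have h1 : ∀ y, ∑ w, pt w * Vn w y ≤ (∏ i, pY (y i)) / α := fun y => by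
      rw [← hmarg, Finset.sum_div]
      refine Finset.sum_le_sum fun w _ => ?_
      rw [mul_div_right_comm]
      exact mul_le_mul_of_nonneg_right (hptle w) (hVn0 w y)
    have h2 : ∀ y w, (∏ i, pY (y i)) * (pn w * if good w y then (1 : ℝ) else 0) ≤
        Real.exp (-γ) * (pn w * Vn w y) := by
      intro y w
      rcases (hpn0 w).eq_or_lt with h | h
      · simp [← h]
      · rw [mul_left_comm, mul_left_comm _ (pn w)]
        refine mul_le_mul_of_nonneg_left ?_ h.le
        split_ifs with hg
        · rw [hgood] at hg
          have hpw : ∀ i, 0 < p (w i) := fun i => lt_of_le_of_ne (hp _) fun h0 =>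
            h.ne' (Finset.prod_eq_zero (Finset.mem_univ i) h0.symm)
          have hpYpos : ∀ i, 0 < pY (y i) := fun i =>
            lt_of_lt_of_le (mul_pos (hpw i) (hg.1 i))
              (Finset.single_le_sum (fun a (_ : a ∈ Finset.univ) => mul_nonneg (hp a) (hV a (y i)))
                (Finset.mem_univ (w i)))
          have hexp := Real.exp_le_exp.2 hg.2
          rw [Real.exp_sum, Finset.prod_congr rfl fun i _ =>
            Real.exp_log (div_pos (hg.1 i) (hpYpos i)), Finset.prod_div_distrib,
            le_div_iff₀ (Finset.prod_pos fun i _ => hpYpos i)] at hexp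
          rw [mul_one, Real.exp_neg, ← div_eq_inv_mul, le_div_iff₀ (Real.exp_pos _), mul_comm]
          exact hexp
        · simpa using mul_nonneg (Real.exp_pos _).le (hVn0 w y)
    have hpYn0 : ∀ y : Fin n → B, 0 ≤ ∏ i, pY (y i) := fun y =>
      (hmarg y) ▸ Finset.sum_nonneg fun w _ => mul_nonneg (hpn0 w) (hVn0 w y)
    calc _ ≤ ∑ y, ((∏ i, pY (y i)) / α) * ∑ w, pn w / α * (if good w y then (1 : ℝ) else 0) := by
          refine Finset.sum_le_sum fun y _ => mul_le_mul (h1 y)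
            (Finset.sum_le_sum fun w _ => mul_le_mul_of_nonneg_right (hptle w)
              (by split_ifs <;> norm_num))
            (Finset.sum_nonneg fun w _ => mul_nonneg (hpt0 w) (by split_ifs <;> norm_num))
            (div_nonneg (hpYn0 y) hα.le)
      _ = (∑ y, ∑ w, (∏ i, pY (y i)) * (pn w * if good w y then (1 : ℝ) else 0)) / α ^ 2 := by
          simp only [Finset.mul_sum, Finset.sum_div]
          refine Finset.sum_congr rfl fun y _ => Finset.sum_congr rfl fun w _ => ?_
          field_simp
      _ ≤ (∑ y, ∑ w, Real.exp (-γ) * (pn w * Vn w y)) / α ^ 2 := by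
          exact div_le_div_of_nonneg_right (Finset.sum_le_sum fun y _ =>
            Finset.sum_le_sum fun w _ => h2 y w) (sq_nonneg α)
      _ = _ := by
          rw [Finset.sum_comm]
          simp only [← Finset.mul_sum]
          have hVn1 : ∀ w, ∑ y, Vn w y = 1 := fun w => sum_prod_channel hV1 w
          have hpn1 : ∑ w, pn w = 1 := by
            rw [hpn, ← Fintype.prod_sum]
            simp [hp1]
          simp [hVn1, hpn1]
  -- the leakage
  have hcov1 : (∑ w, pt w * ∑ z, Un w z ^ (1 + s) * qn z ^ (-s)) ≤ Real.exp κ := by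
    calc _ ≤ ∑ w, pt w * Real.exp κ := by
          refine Finset.sum_le_sum fun w _ => ?_
          rcases (hpt0 w).eq_or_lt with h | h
          · simp [← h]
          · refine mul_le_mul_of_nonneg_left ?_ h.le
            obtain ⟨hw, hκ⟩ := hsupp w h
            have : ∑ z, Un w z ^ (1 + s) * qn z ^ (-s) = ∏ i, G (w i) := by
              rw [hG, Fintype.prod_sum]
              refine Finset.sum_congr rfl fun z _ => ?_
              rw [Finset.prod_mul_distrib, Real.finsetProd_rpow _ _ fun i _ => hU _ _,
                Real.finsetProd_rpow _ _ fun i _ => hq0 _]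
            rw [this]
            refine le_trans (le_of_eq ?_) (Real.exp_le_exp.2 hκ)
            rw [Real.exp_sum]
            exact Finset.prod_congr rfl fun i _ =>
              (Real.exp_log (zero_lt_one.trans_le (hG1 _ (hw i)))).symm
      _ = _ := by rw [← Finset.sum_mul, hpt1, one_mul]
  have hcov2 : ∑ z, (∑ w, pt w * Un w z) ^ (1 + s) * qn z ^ (-s) ≤ α ^ (-s) := by
    have h0 : ∀ z, 0 ≤ ∑ w, pt w * Un w z := fun z =>
      Finset.sum_nonneg fun w _ => mul_nonneg (hpt0 w) (hUn0 w z)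
    have h1 : ∀ z, ∑ w, pt w * Un w z ≤ qn z / α := fun z => by
      rw [← hmargU, Finset.sum_div]
      refine Finset.sum_le_sum fun w _ => ?_
      rw [mul_div_right_comm]
      exact mul_le_mul_of_nonneg_right (hptle w) (hUn0 w z)
    calc _ ≤ ∑ z, (∑ w, pt w * Un w z) * α ^ (-s) := by
          refine Finset.sum_le_sum fun z _ => ?_
          rw [Real.rpow_add_of_nonneg (h0 z) zero_le_one hs.1.le, Real.rpow_one, mul_assoc]
          refine mul_le_mul_of_nonneg_left ?_ (h0 z)
          calc _ ≤ (qn z / α) ^ s * qn z ^ (-s) :=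
                mul_le_mul_of_nonneg_right (Real.rpow_le_rpow (h0 z) (h1 z) hs.1.le)
                  (Real.rpow_nonneg (hqn0 z) _)
            _ = (qn z ^ s * (qn z ^ s)⁻¹) * α ^ (-s) := by
                rw [Real.div_rpow (hqn0 z) hα.le, Real.rpow_neg (hqn0 z), Real.rpow_neg hα.le]
                ring
            -- An inequality rather than an equality, so that `qn z = 0` is covered.
            _ ≤ 1 * α ^ (-s) := mul_le_mul_of_nonneg_right mul_inv_le_one (Real.rpow_nonneg hα.le _)
            _ = _ := one_mul _
      _ = _ := by
          rw [← Finset.sum_mul, Finset.sum_comm]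
          have hUn1 : ∀ w, ∑ z, Un w z = 1 := fun w => sum_prod_channel hU1 w
          simp only [← Finset.mul_sum, hUn1, mul_one, hpt1, one_mul]
  have hE := add_le_add (piE_threshold_error_le (M := M₀ × M₁) hpt0 hpt1 hVn0 good)
    (piE_soft_covering_le (M₀ := M₀) (M₁ := M₁) hpt0 hpt1 hUn0 hqn0 hs)
  rw [← piE_add] at hE
  obtain ⟨c, hcpos, hc⟩ := exists_le_of_piE_le hpt0 hpt1 hE
  obtain ⟨D, hD⟩ := exists_threshold_decoder fun m y => good (c m) y
  have hM : (0 : ℝ) ≤ (Fintype.card (M₀ × M₁) : ℝ)⁻¹ := by positivity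
  have hM₀ : (0 : ℝ) < Fintype.card M₀ := by exact_mod_cast Fintype.card_pos
  have hM₁ : (0 : ℝ) < Fintype.card M₁ := by exact_mod_cast Fintype.card_pos
  have hDc : (Fintype.card (M₀ × M₁) : ℝ)⁻¹ * ∑ m, ∑ y : Fin n → B,
      Vn (c m) y * (if D y = m then 0 else 1) ≤ (Fintype.card (M₀ × M₁) : ℝ)⁻¹ * ∑ m, ∑ y,
        Vn (c m) y * ((if good (c m) y then 0 else 1) +
        ∑ k ∈ Finset.univ.erase m, if good (c k) y then (1 : ℝ) else 0) :=
    mul_le_mul_of_nonneg_left (Finset.sum_le_sum fun m _ => Finset.sum_le_sum fun y _ =>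
      mul_le_mul_of_nonneg_left (hD m y) (hVn0 _ _)) hM
  have hD0 : 0 ≤ (Fintype.card (M₀ × M₁) : ℝ)⁻¹ * ∑ m, ∑ y : Fin n → B,
      Vn (c m) y * (if D y = m then 0 else 1) :=
    mul_nonneg hM (Finset.sum_nonneg fun m _ => Finset.sum_nonneg fun y _ =>
      mul_nonneg (hVn0 _ _) (by split_ifs <;> norm_num))
  -- The averaged power sum never drops below `1` and the error never below `0`, so an upper bound
  -- on their sum close to `1` controls each of them.
  have hS1 : 1 ≤ (Fintype.card M₁ : ℝ)⁻¹ * ∑ m₁, ∑ z : Fin n → C,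
      ((∑ m₀, Un (c (m₀, m₁)) z) / Fintype.card M₀) ^ (1 + s) * qn z ^ (-s) := by
    have : ∀ m₁ : M₁, 1 ≤ ∑ z : Fin n → C,
        ((∑ m₀, Un (c (m₀, m₁)) z) / Fintype.card M₀) ^ (1 + s) * qn z ^ (-s) := by
      intro m₁
      refine one_le_sum_rpow (fun z => div_nonneg (Finset.sum_nonneg fun _ _ => hUn0 _ _) hM₀.le)
        hqn0 ?_ ?_ ?_ hs.1.le
      · rw [← Finset.sum_div, Finset.sum_comm]
        have hUn1 : ∀ w, ∑ z, Un w z = 1 := fun w => sum_prod_channel hU1 w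
        simp [hUn1, hM₀.ne']
      · rw [hqn, ← Fintype.prod_sum]
        simp [hq1]
      · intro z hz
        obtain ⟨i, -, hi⟩ := Finset.prod_eq_zero_iff.1 hz
        rw [Finset.sum_eq_zero, zero_div]
        intro m₀ _
        exact Finset.prod_eq_zero (Finset.mem_univ i)
          (hac _ ((hsupp _ (hcpos (m₀, m₁))).1 i) _ hi)
    calc (1 : ℝ) = (Fintype.card M₁ : ℝ)⁻¹ * ∑ _m₁ : M₁, 1 := by simp [hM₁.ne']
      _ ≤ _ := mul_le_mul_of_nonneg_left (Finset.sum_le_sum fun m₁ _ => this m₁) (by positivity)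
  have hmul1 := mul_le_mul_of_nonneg_left herr2
    (by positivity : (0 : ℝ) ≤ Fintype.card (M₀ × M₁))
  have hmul2 := mul_le_mul_of_nonneg_left hcov1
    (Real.rpow_nonneg hM₀.le (-s))
  rw [← mul_div_assoc] at hmul1
  refine ⟨c, D, fun m => (hsupp _ (hcpos m)).1, hDc.trans ?_, ?_⟩
  · linarith
  · have hS : (Fintype.card M₁ : ℝ)⁻¹ * ∑ m₁, ∑ z : Fin n → C,
        ((∑ m₀, Un (c (m₀, m₁)) z) / Fintype.card M₀) ^ (1 + s) * qn z ^ (-s) ≤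
        1 + (τ / α + Fintype.card (M₀ × M₁) * Real.exp (-γ) / α ^ 2 +
          (Fintype.card M₀ : ℝ) ^ (-s) * Real.exp κ + (α ^ (-s) - 1)) := by linarith
    exact hS

/-! ### Asymptotics of the codebooks, and the limit of orders tending to one. -/

theorem exp_le_msgCount (n : ℕ) (R : ℝ) : Real.exp (n * R) ≤ msgCount n R := Nat.le_ceil _

theorem msgCount_le (n : ℕ) {R : ℝ} (hR : 0 ≤ R) : (msgCount n R : ℝ) ≤ 2 * Real.exp (n * R) := by
  have h1 := (Nat.ceil_lt_add_one (Real.exp_pos (n * R)).le).le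
  have h2 : 1 ≤ Real.exp (n * R) := Real.one_le_exp (by positivity)
  unfold msgCount
  linarith

theorem tendsto_exp_neg_natCast_mul {ε : ℝ} (hε : 0 < ε) :
    Tendsto (fun n : ℕ => Real.exp (-(n * ε))) atTop (𝓝 0) :=
  Real.tendsto_exp_neg_atTop_nhds_zero.comp
    (tendsto_natCast_atTop_atTop.atTop_mul_const hε)

open Classical in
theorem exists_codebook_seq {A B C : Type*} [Fintype A] [Fintype B] [Fintype C]
    {p : A → ℝ} (hp : ∀ a, 0 ≤ p a) (hp1 : ∑ a, p a = 1)
    {V : A → B → ℝ} (hV : ∀ a b, 0 ≤ V a b) (hV1 : ∀ a, ∑ b, V a b = 1)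
    {U : A → C → ℝ} (hU : ∀ a c, 0 ≤ U a c) (hU1 : ∀ a, ∑ c, U a c = 1)
    {q : C → ℝ} (hq : ∀ c, ∑ a, p a * U a c = q c) {s : ℝ} (hs : s ∈ Set.Ioc (0 : ℝ) 1)
    {R₀ R₁ : ℝ} (hR₀ : 0 ≤ R₀) (hR₁ : 0 ≤ R₁)
    (hI : R₀ + R₁ < ∑ ab : A × B, p ab.1 * V ab.1 ab.2 *
      Real.log (V ab.1 ab.2 / ∑ a, p a * V a ab.2))
    (hG : ∑ a, p a * Real.log (∑ c, U a c ^ (1 + s) * q c ^ (-s)) < s * R₀) :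
    ∃ δ : ℕ → ℝ, Tendsto δ atTop (𝓝 0) ∧ ∀ᶠ n in atTop,
      ∃ (c : Msg n R₀ R₁ → Fin n → A) (D : (Fin n → B) → Msg n R₀ R₁), (∀ m i, 0 < p (c m i)) ∧
      (Fintype.card (Msg n R₀ R₁) : ℝ)⁻¹ * ∑ m, ∑ y : Fin n → B,
        (∏ i, V (c m i) (y i)) * (if D y = m then 0 else 1) ≤ δ n ∧
      (msgCount n R₁ : ℝ)⁻¹ * ∑ m₁, ∑ z : Fin n → C,
        ((∑ m₀, ∏ i, U (c (m₀, m₁) i) (z i)) / msgCount n R₀) ^ (1 + s) *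
          (∏ i, q (z i)) ^ (-s) ≤ 1 + δ n := by
  set g : A → ℝ := fun a => Real.log (∑ c, U a c ^ (1 + s) * q c ^ (-s)) with hg
  set μ := ∑ a, p a * g a with hμ
  set f : A × B → ℝ := fun ab => Real.log (V ab.1 ab.2 / ∑ a, p a * V a ab.2) with hf
  set I := ∑ ab : A × B, p ab.1 * V ab.1 ab.2 * f ab
  -- Each gap is split in two: one half makes the weak law applicable, the other leaves an
  -- exponentially small remainder.
  obtain ⟨ε, hε, hεeq⟩ : ∃ ε : ℝ, 0 < ε ∧ μ + 2 * ε = s * R₀ :=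
    ⟨(s * R₀ - μ) / 2, by linarith, by ring⟩
  obtain ⟨η, hη, hηeq⟩ : ∃ η : ℝ, 0 < η ∧ R₀ + R₁ + 2 * η = I :=
    ⟨(I - (R₀ + R₁)) / 2, by linarith, by ring⟩
  have hj : ∀ ab : A × B, 0 ≤ p ab.1 * V ab.1 ab.2 := fun ab => mul_nonneg (hp _) (hV _ _)
  have hj1 : ∑ ab : A × B, p ab.1 * V ab.1 ab.2 = 1 := by
    rw [Fintype.sum_prod_type]
    simp only [← Finset.mul_sum, hV1, mul_one, hp1]
  let τ : ℕ → ℝ := fun n => piE (fun ab : A × B => p ab.1 * V ab.1 ab.2)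
    (fun c : Fin n → A × B => if ∑ i, f (c i) < n * (I - η) then (1 : ℝ) else 0)
  have hτ : Tendsto τ atTop (𝓝 0) := tendsto_piE_lower_tail hj hj1 f hη
  let α : ℕ → ℝ := fun n => piE p
    (fun w : Fin n → A => if ∑ i, g (w i) ≤ n * (μ + ε) then (1 : ℝ) else 0)
  have hα : Tendsto α atTop (𝓝 1) := by
    have h := tendsto_piE_lower_tail hp hp1 (fun a => -g a) hε
    have h2 := (tendsto_const_nhds (x := (1 : ℝ))).sub h
    rw [sub_zero] at h2
    refine h2.congr fun n => ?_
    rw [sub_eq_iff_eq_add, ← piE_add]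
    refine (piE_const (ι := Fin n) hp1 1).symm.trans ?_
    congr 1
    funext w
    simp only [mul_neg, Finset.sum_neg_distrib, ← hμ]
    have e : -∑ i, g (w i) < n * (-μ - ε) ↔ ¬ ∑ i, g (w i) ≤ n * (μ + ε) := by
      rw [not_le, neg_lt]
      have : -((n : ℝ) * (-μ - ε)) = n * (μ + ε) := by ring
      rw [this]
    by_cases h : ∑ i, g (w i) ≤ n * (μ + ε)
    · simp [e, h]
    · simp [e, h]
  have hpos : ∀ᶠ n in atTop, 0 < α n := hα.eventually (lt_mem_nhds one_pos)
  -- The `4` pays for rounding up: each of the two message counts is at most twice its exponential.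
  refine ⟨fun n => τ n / α n + 4 * Real.exp (-(n * η)) / α n ^ 2 + Real.exp (-(n * ε)) +
    (α n ^ (-s) - 1), ?_, ?_⟩
  · have h1 := hτ.div hα one_ne_zero
    have h2 := ((tendsto_exp_neg_natCast_mul hη).const_mul 4).div (hα.pow 2) (by norm_num)
    have h3 := tendsto_exp_neg_natCast_mul hε
    have h4 := (hα.rpow_const (p := -s) (Or.inl one_ne_zero)).sub_const 1
    have h5 := ((h1.add h2).add h3).add h4
    simpa using h5
  · filter_upwards [hpos] with n hn
    obtain ⟨c, D, hc, herr, hleak⟩ := exists_codebook (M₀ := Fin (msgCount n R₀))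
      (M₁ := Fin (msgCount n R₁)) hp hp1 hV hV1 hU hU1 hq hs (κ := n * (μ + ε))
      (γ := n * (I - η)) (α := α n) (τ := τ n) hn rfl rfl
    have hM : (Fintype.card (Fin (msgCount n R₀) × Fin (msgCount n R₁)) : ℝ) *
        Real.exp (-(n * (I - η))) ≤ 4 * Real.exp (-(n * η)) := by
      have h1 : (Fintype.card (Fin (msgCount n R₀) × Fin (msgCount n R₁)) : ℝ) ≤
          (2 * Real.exp (n * R₀)) * (2 * Real.exp (n * R₁)) := by
        rw [Fintype.card_prod, Fintype.card_fin, Fintype.card_fin, Nat.cast_mul]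
        exact mul_le_mul (msgCount_le n hR₀) (msgCount_le n hR₁) (by positivity) (by positivity)
      refine (mul_le_mul_of_nonneg_right h1 (Real.exp_pos _).le).trans (le_of_eq ?_)
      have e : -(n * η) = n * R₀ + n * R₁ + -(n * (I - η)) := by rw [← hηeq]; ring
      rw [e, Real.exp_add, Real.exp_add]
      ring
    have hL : (Fintype.card (Fin (msgCount n R₀)) : ℝ) ^ (-s) * Real.exp (n * (μ + ε)) ≤
        Real.exp (-(n * ε)) := by
      have h1 : (Fintype.card (Fin (msgCount n R₀)) : ℝ) ^ (-s) ≤ Real.exp (n * R₀) ^ (-s) := by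
        rw [Fintype.card_fin]
        exact Real.rpow_le_rpow_of_nonpos (Real.exp_pos _) (exp_le_msgCount n R₀)
          (by linarith [hs.1])
      refine (mul_le_mul_of_nonneg_right h1 (Real.exp_pos _).le).trans (le_of_eq ?_)
      rw [← Real.exp_mul, ← Real.exp_add]
      congr 1
      have : n * (s * R₀) = n * (μ + 2 * ε) := by rw [hεeq]
      linarith
    have hbound := div_le_div_of_nonneg_right hM (sq_nonneg (α n))
    simp only [Fintype.card_fin] at herr hleak hL
    refine ⟨c, D, hc, ?_, ?_⟩
    · refine herr.trans ?_
      linarith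
    · refine hleak.trans ?_
      linarith

/-- Orders slightly above `1` approximate the relative entropy. -/
theorem exists_order_sum_log_lt {A C : Type*} [Fintype A] [Fintype C]
    {p : A → ℝ} (hp : ∀ a, 0 ≤ p a) {U : A → C → ℝ} (hU : ∀ a c, 0 ≤ U a c)
    (hU1 : ∀ a, ∑ c, U a c = 1) {q : C → ℝ} (hq : ∀ c, 0 ≤ q c)
    (hac : ∀ a, 0 < p a → ∀ c, q c = 0 → U a c = 0) {R : ℝ}
    (hR : ∑ a, p a * ∑ c, U a c * Real.log (U a c / q c) < R) :
    ∃ s ∈ Set.Ioc (0 : ℝ) 1,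
      ∑ a, p a * Real.log (∑ c, U a c ^ (1 + s) * q c ^ (-s)) < s * R := by
  -- The exponential form is differentiable at `0` with value `1` there for every `a`, even where
  -- `U` or `q` vanishes. It agrees with the power sum when `p a > 0` and `s > 0`.
  let F : A → ℝ → ℝ := fun a s => ∑ c, U a c * Real.exp (s * Real.log (U a c / q c))
  have hF0 : ∀ a, F a 0 = 1 := fun a => by simp [F, hU1]
  have hFd : ∀ a, HasDerivAt (F a) (∑ c, U a c * Real.log (U a c / q c)) 0 := by
    intro a
    refine HasDerivAt.fun_sum fun c _ => ?_
    have h := (((hasDerivAt_id (0 : ℝ)).mul_const (Real.log (U a c / q c))).exp).const_mul (U a c)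
    simpa using h
  have hd : HasDerivAt (fun s => ∑ a, p a * Real.log (F a s))
      (∑ a, p a * ∑ c, U a c * Real.log (U a c / q c)) 0 := by
    refine HasDerivAt.fun_sum fun a _ => HasDerivAt.const_mul _ ?_
    have h := (hFd a).log (by rw [hF0]; exact one_ne_zero)
    simpa [hF0] using h
  have hlim := hd.tendsto_slope_zero_right
  have hev := (hlim.eventually (gt_mem_nhds hR)).and
    (Ioc_mem_nhdsGT (zero_lt_one' ℝ))
  obtain ⟨s, hsR, hs⟩ := hev.exists
  refine ⟨s, hs, ?_⟩
  simp only [zero_add, hF0, Real.log_one, mul_zero, Finset.sum_const_zero, sub_zero,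
    smul_eq_mul] at hsR
  rw [inv_mul_lt_iff₀ hs.1] at hsR
  refine lt_of_eq_of_lt (Finset.sum_congr rfl fun a _ => ?_) hsR
  rcases (hp a).eq_or_lt with h | h
  · simp [← h]
  · congr 2
    refine Finset.sum_congr rfl fun c _ => ?_
    rcases (hU a c).eq_or_lt with h0 | h0
    · rw [← h0, Real.zero_rpow (by linarith [hs.1])]
      simp
    · have hqc : 0 < q c := lt_of_le_of_ne (hq c) fun e => h0.ne' (hac a h c e.symm)
      rw [Real.rpow_add h0, Real.rpow_one, Real.rpow_neg hqc.le, mul_assoc, ← div_eq_mul_inv,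
        ← Real.div_rpow h0.le hqc.le, Real.rpow_def_of_pos (div_pos h0 hqc), mul_comm s]

/-! ### Distributions on finite alphabets -/

theorem sum_toReal_eq_one {α : Type*} [Fintype α] (P : PMF α) : ∑ a, (P a).toReal = 1 := by
  rw [← ENNReal.toReal_sum fun a _ => P.apply_ne_top a,
    ← tsum_fintype (L := .unconditional α), P.tsum_coe, ENNReal.toReal_one]

theorem bind_apply_fintype {α β : Type*} [Fintype α] (P : PMF α) (V : α → PMF β) (b : β) :
    P.bind V b = ∑ a, P a * V a b := by
  rw [PMF.bind_apply, tsum_fintype]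

theorem toReal_bind {α β : Type*} [Fintype α] (P : PMF α) (V : α → PMF β) (b : β) :
    (P.bind V b).toReal = ∑ a, (P a).toReal * (V a b).toReal := by
  rw [bind_apply_fintype,
    ENNReal.toReal_sum fun a _ => ENNReal.mul_ne_top (P.apply_ne_top a) ((V a).apply_ne_top b)]
  simp only [ENNReal.toReal_mul]

theorem toReal_pos_iff_ne_zero {α : Type*} (P : PMF α) (a : α) : 0 < (P a).toReal ↔ P a ≠ 0 := by
  rw [ENNReal.toReal_pos_iff, pos_iff_ne_zero]
  exact and_iff_left (lt_top_iff_ne_top.2 (P.apply_ne_top a))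

theorem toReal_eq_zero_iff' {α : Type*} (P : PMF α) (a : α) : (P a).toReal = 0 ↔ P a = 0 := by
  simp [ENNReal.toReal_eq_zero_iff, P.apply_ne_top a]

open Classical in
theorem map_prodMk_apply {A B : Type*} (Q : PMF B) (a' a : A) (b : B) :
    Q.map (fun b => (a', b)) (a, b) = if a' = a then Q b else 0 := by
  rw [PMF.map_apply]
  by_cases h : a' = a
  · subst h
    rw [tsum_eq_single b fun b' hb' => by simp [hb'.symm]]
    simp
  · have h' : ¬a = a' := fun e => h e.symm
    simp [h, h']

theorem joint_apply {A B : Type*} (P : PMF A) (V : A → PMF B) (a : A) (b : B) :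
    joint P V (a, b) = P a * V a b := by
  classical
  rw [joint, PMF.bind_apply, tsum_eq_single a fun a' ha' => by
    rw [map_prodMk_apply, if_neg ha', mul_zero], map_prodMk_apply, if_pos rfl]

theorem indep_apply {A B : Type*} (P : PMF A) (Q : PMF B) (a : A) (b : B) :
    indep P Q (a, b) = P a * Q b := joint_apply P _ a b

theorem prodDist_apply {B : Type*} [Fintype B] {n : ℕ} (P : Fin n → PMF B) (b : Fin n → B) :
    prodDist P b = ∏ i, P i (b i) := rfl

theorem toReal_prodDist {B : Type*} [Fintype B] {n : ℕ} (P : Fin n → PMF B) (b : Fin n → B) :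
    (prodDist P b).toReal = ∏ i, (P i (b i)).toReal := by
  rw [prodDist_apply, ENNReal.toReal_prod]

theorem prodDist_bind {A B : Type*} [Fintype A] [Fintype B] {n : ℕ} (P : Fin n → PMF A)
    (V : A → PMF B) :
    ((prodDist P).bind fun a => prodDist fun i => V (a i)) = prodDist fun i => (P i).bind V := by
  classical
  ext b
  rw [bind_apply_fintype, prodDist_apply]
  simp only [bind_apply_fintype, prodDist_apply]
  rw [Fintype.prod_sum]
  exact Finset.sum_congr rfl fun a _ => Finset.prod_mul_distrib.symm

theorem prodDist_pure {B : Type*} [Fintype B] {n : ℕ} (b : Fin n → B) :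
    (prodDist fun i => PMF.pure (b i)) = PMF.pure b := by
  classical
  ext c
  rw [prodDist_apply]
  simp only [PMF.pure_apply]
  by_cases h : c = b
  · subst h
    simp
  · rw [if_neg h]
    obtain ⟨i, hi⟩ := Function.ne_iff.1 h
    exact Finset.prod_eq_zero (Finset.mem_univ i) (if_neg hi)

theorem prodDist_map {A B : Type*} [Fintype A] [Fintype B] {n : ℕ} (P : Fin n → PMF A)
    (f : A → B) : ((prodDist P).map fun a i => f (a i)) = prodDist fun i => (P i).map f := by
  have h := prodDist_bind P (fun a => PMF.pure (f a))
  simp only [prodDist_pure] at h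
  exact h

/-! ### The law induced by a code -/

/-- The output of `n` uses of a memoryless channel with input distribution `E`. -/
noncomputable def blockOutput {X B : Type*} [Fintype B] {n : ℕ} (V : X → PMF B)
    (E : PMF (Fin n → X)) : PMF (Fin n → B) :=
  E.bind fun x => prodDist fun i => V (x i)

theorem blockOutput_prodDist {W X B : Type*} [Fintype X] [Fintype B] {n : ℕ} (V : X → PMF B)
    (K : W → PMF X) (w : Fin n → W) :
    blockOutput V (prodDist fun i => K (w i)) = prodDist fun i => cascade K V (w i) :=
  prodDist_bind _ V

section law

variable {X Y Z : Type*} [Fintype Y] [Fintype Z] {n : ℕ} {R₀ R₁ : ℝ}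

/-- The decoder sees only `Y^n`, so the reliability of a code depends on the channel through its
`Y`-marginal alone; `law_map_secret` is the counterpart for the leakage and `Z`. -/
theorem law_map_messages (c : SecrecyCode X Y n R₀ R₁) (P : X → PMF (Y × Z)) :
    (c.law P).map (fun ω => (ω.1, ω.2.2)) =
      (PMF.uniformOfFintype (Msg n R₀ R₁)).bind fun m =>
        (blockOutput (chanY P) (c.enc m)).bind fun y => (c.dec y).map fun m' => (m, m') := by
  simp only [SecrecyCode.law, blockOutput, PMF.map_bind, PMF.map_comp, PMF.bind_bind]
  refine congrArg _ (funext fun m => congrArg _ (funext fun x => ?_))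
  have h : (prodDist fun i => chanY P (x i)) =
      (prodDist fun i => P (x i)).map fun yz i => (yz i).1 := (prodDist_map _ _).symm
  rw [h, PMF.bind_map]
  rfl

theorem law_map_secret (c : SecrecyCode X Y n R₀ R₁) (P : X → PMF (Y × Z)) :
    (c.law P).map (fun ω => (ω.1.2, ω.2.1)) =
      (PMF.uniformOfFintype (Msg n R₀ R₁)).bind fun m =>
        (blockOutput (chanZ P) (c.enc m)).map fun z => (m.2, z) := by
  simp only [SecrecyCode.law, blockOutput, PMF.map_bind, PMF.map_comp]
  refine congrArg _ (funext fun m => congrArg _ (funext fun x => ?_))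
  have h : (prodDist fun i => chanZ P (x i)) =
      (prodDist fun i => P (x i)).map fun yz i => (yz i).2 := (prodDist_map _ _).symm
  rw [h, PMF.map_comp, ← PMF.bind_pure_comp]
  exact congrArg _ (funext fun yz => PMF.map_const (c.dec fun i => (yz i).1)
    (m.2, fun i => (yz i).2))

theorem errorProb_eq (c : SecrecyCode X Y n R₀ R₁) (P : X → PMF (Y × Z)) :
    c.errorProb P = ∑ m, (Fintype.card (Msg n R₀ R₁) : ℝ≥0∞)⁻¹ *
      ∑ y, blockOutput (chanY P) (c.enc m) y * (c.dec y).toOuterMeasure {m' | m ≠ m'} := by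
  have h : c.errorProb P = ((c.law P).map (fun ω => (ω.1, ω.2.2))).toOuterMeasure
      {x | x.1 ≠ x.2} := by
    rw [PMF.toOuterMeasure_map_apply]
    rfl
  rw [h, law_map_messages, PMF.toOuterMeasure_bind_apply, tsum_fintype]
  refine Finset.sum_congr rfl fun m _ => ?_
  rw [PMF.uniformOfFintype_apply, PMF.toOuterMeasure_bind_apply, tsum_fintype]
  simp only [PMF.toOuterMeasure_map_apply]
  rfl

theorem secretLaw_apply (c : SecrecyCode X Y n R₀ R₁) (P : X → PMF (Y × Z))
    (m₁ : Fin (msgCount n R₁)) (z : Fin n → Z) :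
    (c.law P).map (fun ω => (ω.1.2, ω.2.1)) (m₁, z) =
      ∑ m₀, (Fintype.card (Msg n R₀ R₁) : ℝ≥0∞)⁻¹ * blockOutput (chanZ P) (c.enc (m₀, m₁)) z := by
  classical
  rw [law_map_secret, bind_apply_fintype, Fintype.sum_prod_type]
  refine Finset.sum_congr rfl fun m₀ _ => ?_
  simp only [map_prodMk_apply, PMF.uniformOfFintype_apply, mul_ite, mul_zero, Finset.sum_ite_eq',
    Finset.mem_univ, if_true]

end law

/-! ### Renyi divergence through real sums -/

section renyi

variable {α : Type*} [Fintype α] {P Q : PMF α}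

theorem sum_toReal_rpow_pos (hac : ∀ x, Q x = 0 → P x = 0) (s : ℝ) :
    0 < ∑ x, (P x).toReal ^ (1 + s) * (Q x).toReal ^ (-s) := by
  obtain ⟨x, hx⟩ := P.support_nonempty
  have hP := (toReal_pos_iff_ne_zero P x).2 ((P.mem_support_iff x).1 hx)
  have hQ := (toReal_pos_iff_ne_zero Q x).2 fun h => (P.mem_support_iff x).1 hx (hac x h)
  refine Finset.sum_pos' (fun x _ => by positivity) ⟨x, Finset.mem_univ x, by positivity⟩

/-- Order `0` is excluded because real powers have `0 ^ 0 = 1`, which would count letters outside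
the support of `P`. -/
theorem renyiDiv_eq_coe (hac : ∀ x, Q x = 0 → P x = 0) {s : ℝ} (hs : s ≠ 0) (hs1 : 1 + s ≠ 0) :
    renyiDiv s P Q =
      ((1 / s * Real.log (∑ x, (P x).toReal ^ (1 + s) * (Q x).toReal ^ (-s)) : ℝ) : EReal) := by
  classical
  have h : (∑ x, if P x = 0 then 0 else P x ^ (1 + s) * Q x ^ (-s)) =
      ENNReal.ofReal (∑ x, (P x).toReal ^ (1 + s) * (Q x).toReal ^ (-s)) := by
    rw [ENNReal.ofReal_sum_of_nonneg fun x _ => by positivity]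
    refine Finset.sum_congr rfl fun x _ => ?_
    split_ifs with h
    · simp [h, Real.zero_rpow hs1]
    · have hP := (toReal_pos_iff_ne_zero P x).2 h
      have hQ := (toReal_pos_iff_ne_zero Q x).2 fun h' => h (hac x h')
      rw [ENNReal.ofReal_mul (by positivity), ← ENNReal.ofReal_rpow_of_pos hP,
        ← ENNReal.ofReal_rpow_of_pos hQ, ENNReal.ofReal_toReal (P.apply_ne_top x),
        ENNReal.ofReal_toReal (Q.apply_ne_top x)]
  rw [renyiDiv, if_neg hs, EReal.coe_mul]
  congr 1
  convert (congrArg ENNReal.log h).trans (ENNReal.log_ofReal _) using 1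
  rw [if_neg (not_le.2 (sum_toReal_rpow_pos hac s))]

theorem renyiDiv_zero_eq_coe (hac : ∀ x, Q x = 0 → P x = 0) :
    renyiDiv 0 P Q =
      ((∑ x, (P x).toReal * Real.log ((P x).toReal / (Q x).toReal) : ℝ) : EReal) := by
  rw [renyiDiv, if_pos rfl, if_pos hac]

theorem renyiDiv_self (s : ℝ) (P : PMF α) : renyiDiv s P P = 0 := by
  classical
  by_cases hs : s = 0
  · subst hs
    rw [renyiDiv_zero_eq_coe fun _ => id, Finset.sum_eq_zero, EReal.coe_zero]
    intro x _
    rcases eq_or_ne (P x).toReal 0 with h | h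
    · simp [h]
    · simp [div_self h]
  · have h : (∑ x, if P x = 0 then 0 else P x ^ (1 + s) * P x ^ (-s)) = 1 := by
      rw [← P.tsum_coe, tsum_fintype]
      refine Finset.sum_congr rfl fun x _ => ?_
      split_ifs with h
      · exact h.symm
      · rw [← ENNReal.rpow_add _ _ h (P.apply_ne_top x)]
        simp
    rw [renyiDiv, if_neg hs]
    convert mul_zero _
    convert ENNReal.log_one

/-- The divergence of order `0` vanishes when the supports agree. -/
theorem renyiDiv_neg_one_eq_zero (h : ∀ x, P x = 0 → Q x = 0) : renyiDiv (-1) P Q = 0 := by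
  classical
  have h1 : (∑ x, if P x = 0 then 0 else P x ^ (1 + (-1 : ℝ)) * Q x ^ (-(-1 : ℝ))) = 1 := by
    rw [← Q.tsum_coe, tsum_fintype]
    refine Finset.sum_congr rfl fun x _ => ?_
    split_ifs with hx
    · exact (h x hx).symm
    · simp
  rw [renyiDiv, if_neg (by norm_num)]
  convert mul_zero _
  convert ENNReal.log_one

end renyi

/-- If the power sums of some order `1 + t > 1` tend to `1`, the divergences of that order and of
every order in `(0, 1]` tend to `0`. -/
theorem tendsto_renyiDiv_of_power_sum_le {α : ℕ → Type*} [∀ n, Fintype (α n)]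
    (P Q : ∀ n, PMF (α n)) {t : ℝ} (ht : 0 < t) {s : ℝ} (hs : s = t ∨ s ∈ Set.Ioc (-1) 0)
    {δ : ℕ → ℝ} (hδ : Tendsto δ atTop (𝓝 0))
    (hac : ∀ᶠ n in atTop, ∀ x, Q n x = 0 → P n x = 0)
    (hle : ∀ᶠ n in atTop,
      ∑ x, (P n x).toReal ^ (1 + t) * (Q n x).toReal ^ (-t) ≤ 1 + δ n) :
    Tendsto (fun n => renyiDiv s (P n) (Q n)) atTop (𝓝 0) := by
  let D : ℕ → ℝ := fun n => ∑ x, (P n x).toReal * Real.log ((P n x).toReal / (Q n x).toReal)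
  let F : ℝ → ℕ → ℝ := fun s n => ∑ x, (P n x).toReal ^ (1 + s) * (Q n x).toReal ^ (-s)
  have hac' : ∀ {n}, (∀ x, Q n x = 0 → P n x = 0) →
      ∀ x, (Q n x).toReal = 0 → (P n x).toReal = 0 := fun h x hx =>
    (toReal_eq_zero_iff' _ x).2 (h x ((toReal_eq_zero_iff' _ x).1 hx))
  have hD0 : ∀ᶠ n in atTop, 0 ≤ D n := hac.mono fun n h =>
    sum_mul_log_nonneg (fun x => ENNReal.toReal_nonneg) (fun x => ENNReal.toReal_nonneg)
      (sum_toReal_eq_one _) (sum_toReal_eq_one _) (hac' h)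
  have hFD : ∀ r : ℝ, ∀ᶠ n in atTop, 1 + r * D n ≤ F r n := fun r => hac.mono fun n h =>
    one_add_mul_sum_log_le (fun x => ENNReal.toReal_nonneg) (fun x => ENNReal.toReal_nonneg)
      (sum_toReal_eq_one _) (hac' h) r
  -- From `1 + t * D ≤ F t ≤ 1 + δ` one gets `D ≤ δ / t`.
  have hD : Tendsto D atTop (𝓝 0) := by
    have h1 := hδ.div_const t
    rw [zero_div] at h1
    refine squeeze_zero' hD0 ?_ h1
    filter_upwards [hFD t, hle] with n h1 h2
    rw [le_div_iff₀ ht, mul_comm]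
    have := h1.trans h2
    linarith
  by_cases hs0 : s = 0
  · subst hs0
    refine Tendsto.congr' (hac.mono fun n h => (renyiDiv_zero_eq_coe h).symm) ?_
    exact (continuous_coe_real_ereal.tendsto 0).comp hD
  · have hs1 : 1 + s ≠ 0 := by
      rcases hs with h | h
      · linarith
      · linarith [h.1]
    -- The power sum at `s` is squeezed between `1 + s * D` and either `1 + δ` (if `s = t`) or `1`
    -- (if `s ≤ 0`).
    have hlow : Tendsto (fun n => 1 + s * D n) atTop (𝓝 1) := by
      simpa using (hD.const_mul s).const_add 1
    have hF : Tendsto (F s) atTop (𝓝 1) := by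
      rcases hs with rfl | h
      · have hup : Tendsto (fun n => 1 + δ n) atTop (𝓝 1) := by simpa using hδ.const_add 1
        exact tendsto_of_tendsto_of_tendsto_of_le_of_le' hlow hup (hFD s) hle
      · refine tendsto_of_tendsto_of_tendsto_of_le_of_le' hlow tendsto_const_nhds (hFD s)
          (.of_forall fun n => ?_)
        exact sum_rpow_le_one (fun x => ENNReal.toReal_nonneg) (fun x => ENNReal.toReal_nonneg)
          (sum_toReal_eq_one _) (sum_toReal_eq_one _) ⟨h.1.le, h.2⟩
    refine Tendsto.congr' (hac.mono fun n h => (renyiDiv_eq_coe h hs0 hs1).symm) ?_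
    have h2 := (hF.log one_ne_zero).const_mul (1 / s)
    rw [Real.log_one, mul_zero] at h2
    exact (continuous_coe_real_ereal.tendsto 0).comp h2

/-! ### Codes from codebooks -/

section code

variable {W X Y Z : Type*} [Fintype X] [Fintype Y] [Fintype Z] {n : ℕ} {R₀ R₁ : ℝ}

/-- The code with codewords `c m` sent through the virtual channel `V`, and decoder `D`. -/
noncomputable def codebookCode (V : W → PMF X) (c : Msg n R₀ R₁ → Fin n → W)
    (D : (Fin n → Y) → Msg n R₀ R₁) : SecrecyCode X Y n R₀ R₁ where
  enc m := prodDist fun i => V (c m i)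
  dec y := PMF.pure (D y)

theorem errorProb_codebookCode (V : W → PMF X) (c : Msg n R₀ R₁ → Fin n → W)
    (D : (Fin n → Y) → Msg n R₀ R₁) (P : X → PMF (Y × Z)) :
    (codebookCode V c D).errorProb P = ENNReal.ofReal ((Fintype.card (Msg n R₀ R₁) : ℝ)⁻¹ *
      ∑ m, ∑ y : Fin n → Y, (∏ i, (cascade V (chanY P) (c m i) (y i)).toReal) *
        (if D y = m then 0 else 1)) := by
  have hcard : (0 : ℝ) < Fintype.card (Msg n R₀ R₁) := by exact_mod_cast Fintype.card_pos
  have h0 : ∀ m y, 0 ≤ (∏ i, (cascade V (chanY P) (c m i) (y i)).toReal) *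
      (if D y = m then (0 : ℝ) else 1) := fun m y => by positivity
  rw [errorProb_eq, Finset.mul_sum, ENNReal.ofReal_sum_of_nonneg fun m _ =>
    mul_nonneg (inv_nonneg.2 hcard.le) (Finset.sum_nonneg fun y _ => h0 m y)]
  refine Finset.sum_congr rfl fun m _ => ?_
  rw [ENNReal.ofReal_mul (inv_nonneg.2 hcard.le), ENNReal.ofReal_inv_of_pos hcard,
    ENNReal.ofReal_natCast, ENNReal.ofReal_sum_of_nonneg fun y _ => h0 m y]
  congr 1
  refine Finset.sum_congr rfl fun y _ => ?_
  simp only [codebookCode]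
  rw [blockOutput_prodDist, ENNReal.ofReal_mul (by positivity), ← toReal_prodDist,
    ENNReal.ofReal_toReal (PMF.apply_ne_top _ _), PMF.toOuterMeasure_pure_apply]
  congr 1
  by_cases h : D y = m
  · simp [h]
  · have h' : ¬m = D y := fun e => h e.symm
    simp [h, h']

theorem toReal_secretLaw_codebookCode (V : W → PMF X) (c : Msg n R₀ R₁ → Fin n → W)
    (D : (Fin n → Y) → Msg n R₀ R₁) (P : X → PMF (Y × Z)) (m₁ : Fin (msgCount n R₁))
    (z : Fin n → Z) :
    (((codebookCode V c D).law P).map (fun ω => (ω.1.2, ω.2.1)) (m₁, z)).toReal =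
      (msgCount n R₁ : ℝ)⁻¹ *
        ((∑ m₀, ∏ i, (cascade V (chanZ P) (c (m₀, m₁) i) (z i)).toReal) / msgCount n R₀) := by
  rw [secretLaw_apply, ENNReal.toReal_sum fun m₀ _ => ENNReal.mul_ne_top
    (ENNReal.inv_ne_top.2 (Nat.cast_ne_zero.2 Fintype.card_ne_zero)) (PMF.apply_ne_top _ _)]
  simp only [codebookCode, blockOutput_prodDist, ENNReal.toReal_mul, toReal_prodDist,
    ENNReal.toReal_inv, ENNReal.toReal_natCast, Fintype.card_prod, Fintype.card_fin, Nat.cast_mul,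
    ← Finset.mul_sum]
  rw [mul_inv]
  ring

theorem toReal_indep_uniform (Q : PMF Z) (m₁ : Fin (msgCount n R₁)) (z : Fin n → Z) :
    (indep (PMF.uniformOfFintype (Fin (msgCount n R₁))) (prodDist fun _ : Fin n => Q)
      (m₁, z)).toReal = (msgCount n R₁ : ℝ)⁻¹ * ∏ i, (Q (z i)).toReal := by
  rw [indep_apply, ENNReal.toReal_mul, toReal_prodDist, PMF.uniformOfFintype_apply,
    ENNReal.toReal_inv, ENNReal.toReal_natCast, Fintype.card_fin]

/-- The uniform weight of `m₁` enters with exponents `1 + t` and `-t`, so a single factor survives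
and turns the sum over `m₁` into an average. -/
theorem power_sum_codebookCode (V : W → PMF X) (c : Msg n R₀ R₁ → Fin n → W)
    (D : (Fin n → Y) → Msg n R₀ R₁) (P : X → PMF (Y × Z)) (Q : PMF Z) (t : ℝ) :
    ∑ x, (((codebookCode V c D).law P).map (fun ω => (ω.1.2, ω.2.1)) x).toReal ^ (1 + t) *
      (indep (PMF.uniformOfFintype (Fin (msgCount n R₁))) (prodDist fun _ : Fin n => Q)
        x).toReal ^ (-t) =
      (msgCount n R₁ : ℝ)⁻¹ * ∑ m₁, ∑ z : Fin n → Z,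
        ((∑ m₀, ∏ i, (cascade V (chanZ P) (c (m₀, m₁) i) (z i)).toReal) /
          msgCount n R₀) ^ (1 + t) * (∏ i, (Q (z i)).toReal) ^ (-t) := by
  have hM : (0 : ℝ) < (msgCount n R₁ : ℝ)⁻¹ :=
    inv_pos.2 (Nat.cast_pos.2 (NeZero.pos (msgCount n R₁)))
  rw [Fintype.sum_prod_type]
  simp only [Finset.mul_sum]
  refine Finset.sum_congr rfl fun m₁ _ => Finset.sum_congr rfl fun z _ => ?_
  rw [toReal_secretLaw_codebookCode, toReal_indep_uniform, Real.mul_rpow hM.le (by positivity),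
    Real.mul_rpow hM.le (by positivity), mul_mul_mul_comm, ← Real.rpow_add hM]
  simp

theorem secretLaw_codebookCode_eq_zero {V : W → PMF X} {c : Msg n R₀ R₁ → Fin n → W}
    {D : (Fin n → Y) → Msg n R₀ R₁} {P : X → PMF (Y × Z)} {Q : PMF Z}
    (hac : ∀ m i z, Q z = 0 → cascade V (chanZ P) (c m i) z = 0)
    {x : Fin (msgCount n R₁) × (Fin n → Z)}
    (hx : indep (PMF.uniformOfFintype (Fin (msgCount n R₁))) (prodDist fun _ : Fin n => Q) x = 0) :
    ((codebookCode V c D).law P).map (fun ω => (ω.1.2, ω.2.1)) x = 0 := by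
  obtain ⟨m₁, z⟩ := x
  rw [← toReal_eq_zero_iff', toReal_indep_uniform] at hx
  have hM : (msgCount n R₁ : ℝ)⁻¹ ≠ 0 := inv_ne_zero (Nat.cast_ne_zero.2 (NeZero.ne _))
  obtain ⟨i, -, hi⟩ := Finset.prod_eq_zero_iff.1 ((mul_eq_zero.1 hx).resolve_left hM)
  rw [← toReal_eq_zero_iff', toReal_secretLaw_codebookCode, Finset.sum_eq_zero, zero_div, mul_zero]
  intro m₀ _
  refine Finset.prod_eq_zero (Finset.mem_univ i) ?_
  rw [toReal_eq_zero_iff'] at hi ⊢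
  exact hac _ _ _ hi

end code

/-! ### Real forms of the information quantities -/

theorem apply_eq_zero_of_bind_eq {A B : Type*} {PA : PMF A} {U : A → PMF B} {Q : PMF B}
    (h : PA.bind U = Q) {a : A} (ha : PA a ≠ 0) {b : B} (hb : Q b = 0) : U a b = 0 := by
  rw [← h, PMF.bind_apply, ENNReal.tsum_eq_zero] at hb
  exact (mul_eq_zero.1 (hb a)).resolve_left ha

theorem mutualInfo_eq_coe {A B : Type*} [Fintype A] [Fintype B] (PA : PMF A) (U : A → PMF B) :
    mutualInfo PA U = ((∑ ab : A × B, (PA ab.1).toReal * (U ab.1 ab.2).toReal *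
      Real.log ((U ab.1 ab.2).toReal / ∑ a, (PA a).toReal * (U a ab.2).toReal) : ℝ) : EReal) := by
  have hac : ∀ x, indep PA (PA.bind U) x = 0 → joint PA U x = 0 := by
    rintro ⟨a, b⟩ h
    rw [indep_apply] at h
    rw [joint_apply]
    by_cases ha : PA a = 0
    · simp [ha]
    · rw [apply_eq_zero_of_bind_eq rfl ha ((mul_eq_zero.1 h).resolve_left ha), mul_zero]
  rw [mutualInfo, relEntropy, renyiDiv_zero_eq_coe hac]
  congr 1
  refine Finset.sum_congr rfl fun ⟨a, b⟩ _ => ?_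
  rw [joint_apply, indep_apply, ENNReal.toReal_mul, ENNReal.toReal_mul, toReal_bind]
  by_cases ha : (PA a).toReal = 0
  · simp [ha]
  · rw [mul_div_mul_left _ _ ha]

/-- A letter of zero weight may have infinite divergence; `0 * ⊤ = 0` makes it harmless. -/
theorem coe_mul_renyiDiv {A B : Type*} [Fintype B] {PA : PMF A} {U : A → PMF B}
    {Q : PMF B} {s : ℝ} {a : A} {d : ℝ} (h : PA a ≠ 0 → renyiDiv s (U a) Q = (d : EReal)) :
    (PA a : EReal) * renyiDiv s (U a) Q = (((PA a).toReal * d : ℝ) : EReal) := by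
  by_cases ha : PA a = 0
  · simp [ha]
  · rw [h ha, EReal.coe_mul, EReal.coe_ennreal_toReal (PA.apply_ne_top a)]

theorem ereal_coe_sum {ι : Type*} (t : Finset ι) (f : ι → ℝ) :
    ((∑ i ∈ t, f i : ℝ) : EReal) = ∑ i ∈ t, (f i : EReal) := by
  classical
  induction t using Finset.induction_on with
  | empty => simp
  | insert a t ha ih => rw [Finset.sum_insert ha, Finset.sum_insert ha, EReal.coe_add, ih]

theorem rTilde_of_pos {A B : Type*} [Fintype A] [Fintype B] {PA : PMF A} {U : A → PMF B}
    {Q : PMF B} (h : PA.bind U = Q) {s : ℝ} (hs : 0 < s) :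
    rTilde s PA U Q = ((∑ a, (PA a).toReal * (1 / s * Real.log
      (∑ b, (U a b).toReal ^ (1 + s) * (Q b).toReal ^ (-s))) : ℝ) : EReal) := by
  rw [rTilde, if_pos hs, ereal_coe_sum]
  exact Finset.sum_congr rfl fun a _ => coe_mul_renyiDiv fun ha =>
    renyiDiv_eq_coe (fun b hb => apply_eq_zero_of_bind_eq h ha hb) hs.ne' (by linarith)

theorem rTilde_of_nonpos {A B : Type*} [Fintype A] [Fintype B] {PA : PMF A} {U : A → PMF B}
    {Q : PMF B} (h : PA.bind U = Q) {s : ℝ} (hs : s ∈ Set.Ioc (-1) 0) :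
    rTilde s PA U Q = ((∑ a, (PA a).toReal * ∑ b, (U a b).toReal *
      Real.log ((U a b).toReal / (Q b).toReal) : ℝ) : EReal) := by
  rw [rTilde, if_neg (not_lt.2 hs.2), if_pos hs.1, ereal_coe_sum]
  exact Finset.sum_congr rfl fun a _ => coe_mul_renyiDiv fun ha =>
    renyiDiv_zero_eq_coe fun b hb => apply_eq_zero_of_bind_eq h ha hb

theorem nonempty_secrecyCode {X Y : Type*} [Fintype X] (x : PMF X) (n : ℕ) (R₀ R₁ : ℝ) :
    Nonempty (SecrecyCode X Y n R₀ R₁) :=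
  ⟨⟨fun _ => prodDist fun _ => x, fun _ => PMF.pure (0, 0)⟩⟩

/-- Achievability asks for a code at every blocklength; the finitely many not covered by the
asymptotic bounds get an arbitrary one. -/
theorem exists_seq_of_eventually {α : ℕ → Type*} [∀ n, Nonempty (α n)] {p : ∀ n, α n → Prop}
    (h : ∀ᶠ n in atTop, ∃ a, p n a) : ∃ a : ∀ n, α n, ∀ᶠ n in atTop, p n (a n) := by
  classical
  refine ⟨fun n => if hn : ∃ a, p n a then hn.choose else Classical.arbitrary _, ?_⟩
  filter_upwards [h] with n hn
  rw [dif_pos hn]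
  exact hn.choose_spec

theorem ennreal_tendsto_zero_of_le_ofReal {f : ℕ → ℝ≥0∞} {δ : ℕ → ℝ}
    (hδ : Tendsto δ atTop (𝓝 0)) (h : ∀ᶠ n in atTop, f n ≤ ENNReal.ofReal (δ n)) :
    Tendsto f atTop (𝓝 0) := by
  have h0 := ENNReal.tendsto_ofReal hδ
  rw [ENNReal.ofReal_zero] at h0
  exact tendsto_of_tendsto_of_tendsto_of_le_of_le' tendsto_const_nhds h0
    (.of_forall fun n => bot_le) h

/-! ### Stochastic encoding -/

theorem blockOutput_iid {W X B : Type*} [Fintype X] [Fintype B] {K : X → PMF B} {V : W → PMF X}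
    {PW : PMF W} {Q : PMF B} (hQ : PW.bind (cascade V K) = Q) (n : ℕ) :
    blockOutput K (prodDist fun _ : Fin n => PW.bind V) = prodDist fun _ => Q := by
  have h : (PW.bind V).bind K = Q := by
    rw [PMF.bind_bind]
    exact hQ
  rw [← h]
  exact prodDist_bind _ K

/-- The mixture of `E` and `F` with weights `1 / (n + 1)` and `n / (n + 1)`. -/
noncomputable def mixture {A : Type*} (n : ℕ) (E F : PMF A) : PMF A :=
  (PMF.uniformOfFintype (Fin (n + 1))).bind fun j => if j = 0 then E else F

theorem mixture_apply {A : Type*} (n : ℕ) (E F : PMF A) (a : A) :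
    mixture n E F a = ((n : ℝ≥0∞) + 1)⁻¹ * E a + n * (((n : ℝ≥0∞) + 1)⁻¹ * F a) := by
  rw [mixture, bind_apply_fintype, Fin.sum_univ_succ]
  simp [PMF.uniformOfFintype_apply, Fin.succ_ne_zero]

theorem mixture_apply_le {A : Type*} (n : ℕ) (E F : PMF A) (a : A) :
    mixture n E F a ≤ ((n : ℝ≥0∞) + 1)⁻¹ * E a + F a := by
  rw [mixture_apply, ← mul_assoc, ← div_eq_mul_inv]
  gcongr
  refine mul_le_of_le_one_left' (ENNReal.div_le_of_le_mul ?_)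
  rw [one_mul]
  exact le_self_add

theorem eq_zero_of_mixture_apply_eq_zero {A : Type*} {n : ℕ} {E F : PMF A} {a : A}
    (h : mixture n E F a = 0) : E a = 0 := by
  rw [mixture_apply] at h
  have h1 := (add_eq_zero.1 h).1
  refine (mul_eq_zero.1 h1).resolve_left (ENNReal.inv_ne_zero.2 ?_)
  exact ENNReal.add_ne_top.2 ⟨ENNReal.natCast_ne_top n, ENNReal.one_ne_top⟩

theorem blockOutput_mixture {X B : Type*} [Fintype B] {n k : ℕ} (K : X → PMF B)
    (E F : PMF (Fin n → X)) :
    blockOutput K (mixture k E F) = mixture k (blockOutput K E) (blockOutput K F) := by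
  rw [blockOutput, mixture, PMF.bind_bind]
  refine congrArg _ (funext fun j => ?_)
  split_ifs <;> rfl

/-- The code `c` with an encoder that, with probability `1 / (n + 1)`, sends a word drawn from `E`
instead of the codeword. -/
noncomputable def SecrecyCode.blend {X Y : Type*} {n : ℕ} {R₀ R₁ : ℝ}
    (c : SecrecyCode X Y n R₀ R₁) (E : PMF (Fin n → X)) : SecrecyCode X Y n R₀ R₁ where
  enc m := mixture n E (c.enc m)
  dec := c.dec

theorem errorProb_blend_le {X Y Z : Type*} [Fintype Y] [Fintype Z] {n : ℕ} {R₀ R₁ : ℝ}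
    (c : SecrecyCode X Y n R₀ R₁) (E : PMF (Fin n → X)) (P : X → PMF (Y × Z)) :
    (c.blend E).errorProb P ≤ ((n : ℝ≥0∞) + 1)⁻¹ + c.errorProb P := by
  have hcard : (Fintype.card (Msg n R₀ R₁) : ℝ≥0∞) ≠ 0 := Nat.cast_ne_zero.2 Fintype.card_ne_zero
  have hle : ∀ m : Msg n R₀ R₁, ∑ y, blockOutput (chanY P) E y *
      (c.dec y).toOuterMeasure {m' | m ≠ m'} ≤ 1 := by
    intro m
    rw [← (blockOutput (chanY P) E).tsum_coe, tsum_fintype]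
    refine Finset.sum_le_sum fun y _ => mul_le_of_le_one_right' ?_
    exact ((c.dec y).toOuterMeasure.mono (Set.subset_univ _)).trans
      (((c.dec y).toOuterMeasure_apply_eq_one_iff Set.univ).2 (Set.subset_univ _)).le
  rw [errorProb_eq, errorProb_eq]
  calc _ ≤ ∑ m, (Fintype.card (Msg n R₀ R₁) : ℝ≥0∞)⁻¹ * (((n : ℝ≥0∞) + 1)⁻¹ +
        ∑ y, blockOutput (chanY P) (c.enc m) y * (c.dec y).toOuterMeasure {m' | m ≠ m'}) := by
        refine Finset.sum_le_sum fun m _ => mul_le_mul_right ?_ _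
        simp only [SecrecyCode.blend, blockOutput_mixture]
        calc _ ≤ ∑ y, (((n : ℝ≥0∞) + 1)⁻¹ * (blockOutput (chanY P) E y *
              (c.dec y).toOuterMeasure {m' | m ≠ m'}) + blockOutput (chanY P) (c.enc m) y *
              (c.dec y).toOuterMeasure {m' | m ≠ m'}) := by
              refine Finset.sum_le_sum fun y _ => ?_
              rw [← mul_assoc, ← add_mul]
              exact mul_le_mul_left (mixture_apply_le _ _ _ _) _
          _ ≤ _ := by
              rw [Finset.sum_add_distrib, ← Finset.mul_sum]
              gcongr
              exact mul_le_of_le_one_right' (hle m)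
    _ = _ := by
        simp only [mul_add, Finset.sum_add_distrib]
        congr 1
        rw [Finset.sum_const, Finset.card_univ, nsmul_eq_mul, ← mul_assoc,
          ENNReal.mul_inv_cancel hcard (ENNReal.natCast_ne_top _), one_mul]

/-- At order `0` only supports count, and any positive share of words inducing `Q^n` gives the
output a support containing that of `Q^n`. The leakage is thus exactly zero at every blocklength. -/
theorem leakage_blend_eq_zero {X Y Z : Type*} [Fintype Y] [Fintype Z] {n : ℕ} {R₀ R₁ : ℝ}
    (c : SecrecyCode X Y n R₀ R₁) {E : PMF (Fin n → X)} {P : X → PMF (Y × Z)} {Q : PMF Z}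
    (hE : blockOutput (chanZ P) E = prodDist fun _ => Q) :
    (c.blend E).leakage P Q (-1) = 0 := by
  refine renyiDiv_neg_one_eq_zero fun ⟨m₁, z⟩ hz => ?_
  rw [secretLaw_apply, Finset.sum_eq_zero_iff] at hz
  have h := (mul_eq_zero.1 (hz 0 (Finset.mem_univ _))).resolve_left
    (ENNReal.inv_ne_zero.2 (ENNReal.natCast_ne_top _))
  simp only [SecrecyCode.blend, blockOutput_mixture] at h
  rw [indep_apply, ← hE, eq_zero_of_mixture_apply_eq_zero h, mul_zero]

/-! ### Rate zero -/

theorem msgCount_zero (n : ℕ) : msgCount n 0 = 1 := by simp [msgCount]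

/-- There is a single message pair, hence no error, and i.i.d. inputs produce exactly `Q^n`. This
covers `I(W;Y) = 0`, where no pair satisfies the strict inequalities. -/
theorem isAchievable_zero {W X Y Z : Type*} [Fintype X] [Fintype Y] [Fintype Z]
    (P : X → PMF (Y × Z)) {Q : PMF Z} {V : W → PMF X} {PW : PMF W}
    (hQ : PW.bind (cascade V (chanZ P)) = Q) (s : ℝ) : IsAchievable P Q s 0 0 := by
  have hsub : ∀ n, Subsingleton (Fin (msgCount n 0)) := fun n => by
    rw [msgCount_zero]
    infer_instance
  refine ⟨le_rfl, le_rfl,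
    fun n => ⟨fun _ => prodDist fun _ => PW.bind V, fun _ => PMF.pure (0, 0)⟩, ?_, ?_⟩
  · refine tendsto_const_nhds.congr fun n => ?_
    rw [SecrecyCode.errorProb]
    have : {ω : Msg n 0 0 × (Fin n → Z) × Msg n 0 0 | ω.1 ≠ ω.2.2} = ∅ := by
      ext ω
      simpa using Subsingleton.elim _ _
    rw [this]
    exact MeasureTheory.measure_empty.symm
  · refine tendsto_const_nhds.congr fun n => ?_
    let c : SecrecyCode X Y n 0 0 := ⟨fun _ => prodDist fun _ => PW.bind V, fun _ => PMF.pure (0, 0)⟩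
    have hlaw : (c.law P).map (fun ω => (ω.1.2, ω.2.1)) =
        indep (PMF.uniformOfFintype (Fin (msgCount n 0))) (prodDist fun _ : Fin n => Q) := by
      ext ⟨m₁, z⟩
      rw [secretLaw_apply, indep_apply, PMF.uniformOfFintype_apply]
      simp only [c, blockOutput_iid hQ]
      simp [msgCount_zero]
    exact ((congrArg (fun L => renyiDiv s L _) hlaw).trans (renyiDiv_self s _)).symm

/-! ### Achievable rate pairs -/

section achievability

variable {W X Y Z : Type*} [Fintype W] [Fintype X] [Fintype Y] [Fintype Z]

/-- Rate pairs that satisfy the covering condition at some order `1 + t ∈ (1, 2]` are achieved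
with a leakage that vanishes at the order `1 + t` and at all orders in `(0, 1]`. -/
theorem isAchievable_of_sum_log_lt (P : X → PMF (Y × Z)) {Q : PMF Z} {V : W → PMF X} {PW : PMF W}
    (hQ : PW.bind (cascade V (chanZ P)) = Q) {t : ℝ} (ht : t ∈ Set.Ioc (0 : ℝ) 1) {s : ℝ}
    (hs : s = t ∨ s ∈ Set.Ioc (-1) 0) {R₀ R₁ : ℝ} (hR₀ : 0 ≤ R₀) (hR₁ : 0 ≤ R₁)
    (hI : ((R₀ + R₁ : ℝ) : EReal) < mutualInfo PW (cascade V (chanY P)))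
    (hG : ∑ w, (PW w).toReal * Real.log (∑ z, (cascade V (chanZ P) w z).toReal ^ (1 + t) *
      (Q z).toReal ^ (-t)) < t * R₀) : IsAchievable P Q s R₀ R₁ := by
  rw [mutualInfo_eq_coe, EReal.coe_lt_coe_iff] at hI
  obtain ⟨δ, hδ, hev⟩ := exists_codebook_seq (fun w => ENNReal.toReal_nonneg)
    (sum_toReal_eq_one PW) (V := fun w y => (cascade V (chanY P) w y).toReal)
    (fun _ _ => ENNReal.toReal_nonneg) (fun w => sum_toReal_eq_one _)
    (U := fun w z => (cascade V (chanZ P) w z).toReal)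
    (fun _ _ => ENNReal.toReal_nonneg) (fun w => sum_toReal_eq_one _)
    (q := fun z => (Q z).toReal) (fun z => by rw [← hQ, toReal_bind]) ht hR₀ hR₁ hI hG
  obtain ⟨w₀, -⟩ := PW.support_nonempty
  have : ∀ n, Nonempty (SecrecyCode X Y n R₀ R₁) := fun n => nonempty_secrecyCode (V w₀) n R₀ R₁
  have hcode : ∀ᶠ n in atTop, ∃ C : SecrecyCode X Y n R₀ R₁,
      C.errorProb P ≤ ENNReal.ofReal (δ n) ∧
      (∀ x, indep (PMF.uniformOfFintype (Fin (msgCount n R₁))) (prodDist fun _ : Fin n => Q) x = 0 →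
        (C.law P).map (fun ω => (ω.1.2, ω.2.1)) x = 0) ∧
      ∑ x, ((C.law P).map (fun ω => (ω.1.2, ω.2.1)) x).toReal ^ (1 + t) *
        (indep (PMF.uniformOfFintype (Fin (msgCount n R₁))) (prodDist fun _ : Fin n => Q)
          x).toReal ^ (-t) ≤ 1 + δ n := by
    filter_upwards [hev] with n hn
    obtain ⟨c, D, hc, herr, hleak⟩ := hn
    refine ⟨codebookCode V c D, ?_, fun x hx => ?_, ?_⟩
    · rw [errorProb_codebookCode]
      refine ENNReal.ofReal_le_ofReal ?_
      convert herr
    · refine secretLaw_codebookCode_eq_zero (fun m i z hz => ?_) hx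
      exact apply_eq_zero_of_bind_eq hQ ((toReal_pos_iff_ne_zero _ _).1 (hc m i)) hz
    · rw [power_sum_codebookCode]
      exact hleak
  obtain ⟨C, hC⟩ := exists_seq_of_eventually hcode
  refine ⟨hR₀, hR₁, C, ennreal_tendsto_zero_of_le_ofReal hδ (hC.mono fun n h => h.1), ?_⟩
  exact tendsto_renyiDiv_of_power_sum_le _ _ ht.1 hs hδ (hC.mono fun n h => h.2.1)
    (hC.mono fun n h => h.2.2)

theorem isAchievable_neg_one (P : X → PMF (Y × Z)) {Q : PMF Z} {V : W → PMF X} {PW : PMF W}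
    (hQ : PW.bind (cascade V (chanZ P)) = Q) {R₀ R₁ : ℝ} (hR₀ : 0 < R₀) (hR₁ : 0 ≤ R₁)
    (hI : ((R₀ + R₁ : ℝ) : EReal) < mutualInfo PW (cascade V (chanY P))) :
    IsAchievable P Q (-1) R₀ R₁ := by
  rw [mutualInfo_eq_coe, EReal.coe_lt_coe_iff] at hI
  obtain ⟨δ, hδ, hev⟩ := exists_codebook_seq (fun w => ENNReal.toReal_nonneg)
    (sum_toReal_eq_one PW) (V := fun w y => (cascade V (chanY P) w y).toReal)
    (fun _ _ => ENNReal.toReal_nonneg) (fun w => sum_toReal_eq_one _)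
    -- No covering is needed, so the wiretapper is replaced by one with a one-letter alphabet. The
    -- covering condition then reads `0 < R₀`.
    (U := fun _ (_ : Unit) => 1) (fun _ _ => zero_le_one) (fun _ => by simp)
    (q := fun _ => 1) (fun _ => by simpa using sum_toReal_eq_one PW)
    ⟨one_pos, le_rfl⟩ hR₀.le hR₁ hI (by simpa using hR₀)
  obtain ⟨w₀, -⟩ := PW.support_nonempty
  have : ∀ n, Nonempty (SecrecyCode X Y n R₀ R₁) := fun n => nonempty_secrecyCode (V w₀) n R₀ R₁
  have hcode : ∀ᶠ n in atTop, ∃ C : SecrecyCode X Y n R₀ R₁,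
      C.errorProb P ≤ ENNReal.ofReal (δ n) := by
    filter_upwards [hev] with n hn
    obtain ⟨c, D, -, herr, -⟩ := hn
    refine ⟨codebookCode V c D, ?_⟩
    rw [errorProb_codebookCode]
    refine ENNReal.ofReal_le_ofReal ?_
    convert herr
  obtain ⟨C, hC⟩ := exists_seq_of_eventually hcode
  refine ⟨hR₀.le, hR₁, fun n => (C n).blend (prodDist fun _ => PW.bind V), ?_, ?_⟩
  · have h1 : Tendsto (fun n : ℕ => ((n : ℝ≥0∞) + 1)⁻¹) atTop (𝓝 0) := by
      have := ENNReal.tendsto_inv_nat_nhds_zero.comp (tendsto_add_atTop_nat 1)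
      refine this.congr fun n => ?_
      simp
    have h2 := h1.add (ennreal_tendsto_zero_of_le_ofReal hδ hC)
    rw [add_zero] at h2
    exact tendsto_of_tendsto_of_tendsto_of_le_of_le tendsto_const_nhds h2
      (fun n => bot_le) fun n => errorProb_blend_le _ _ _
  · simp only [leakage_blend_eq_zero _ (blockOutput_iid hQ _)]
    exact tendsto_const_nhds

/-! ### The region -/

theorem isAchievable_of_rTilde_lt (P : X → PMF (Y × Z)) {Q : PMF Z} {V : W → PMF X} {PW : PMF W}
    (hQ : PW.bind (cascade V (chanZ P)) = Q) {s : ℝ} (hs : s ∈ Set.Icc (-1 : ℝ) 1) {R₀ R₁ : ℝ}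
    (hR₀ : 0 ≤ R₀) (hR₁ : 0 ≤ R₁)
    (hI : ((R₀ + R₁ : ℝ) : EReal) < mutualInfo PW (cascade V (chanY P)))
    (hR : rTilde s PW (cascade V (chanZ P)) Q < (R₀ : EReal)) : IsAchievable P Q s R₀ R₁ := by
  rcases lt_or_ge 0 s with hs0 | hs0
  · refine isAchievable_of_sum_log_lt P hQ ⟨hs0, hs.2⟩ (Or.inl rfl) hR₀ hR₁ hI ?_
    rw [rTilde_of_pos hQ hs0, EReal.coe_lt_coe_iff] at hR
    rw [mul_comm, ← div_lt_iff₀ hs0, Finset.sum_div]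
    refine lt_of_eq_of_lt (Finset.sum_congr rfl fun w _ => ?_) hR
    ring
  · rcases hs.1.eq_or_lt with h | h
    · subst h
      have hpos : 0 < R₀ := by
        rw [rTilde, if_neg (by norm_num), if_neg (lt_irrefl _)] at hR
        exact_mod_cast hR
      exact isAchievable_neg_one P hQ hpos hR₁ hI
    · rw [rTilde_of_nonpos hQ ⟨h, hs0⟩, EReal.coe_lt_coe_iff] at hR
      obtain ⟨t, ht, hG⟩ := exists_order_sum_log_lt (fun _ => ENNReal.toReal_nonneg)
        (U := fun w z => (cascade V (chanZ P) w z).toReal) (fun _ _ => ENNReal.toReal_nonneg)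
        (fun w => sum_toReal_eq_one _) (q := fun z => (Q z).toReal)
        (fun _ => ENNReal.toReal_nonneg) (fun w hw z hz => (toReal_eq_zero_iff' _ _).2
          (apply_eq_zero_of_bind_eq hQ ((toReal_pos_iff_ne_zero _ _).1 hw)
            ((toReal_eq_zero_iff' _ _).1 hz))) hR
      exact isAchievable_of_sum_log_lt P hQ ht (Or.inr ⟨h, hs0⟩) hR₀ hR₁ hI hG

theorem ratePairs_subset_admissibleRegion (P : X → PMF (Y × Z)) {Q : PMF Z} {V : W → PMF X}
    {PW : PMF W} (hQ : PW.bind (cascade V (chanZ P)) = Q) {s : ℝ} (hs : s ∈ Set.Icc (-1 : ℝ) 1)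
    (hdeg : ¬ IsDegenerate P Q s V PW) : ratePairs P Q s V PW ⊆ admissibleRegion P Q s := by
  rintro ⟨r₀, r₁⟩ ⟨hr₀, hr₁, hsum, hr⟩
  dsimp only at hr₀ hr₁ hsum hr
  by_cases hpos : 0 < mutualInfo PW (cascade V (chanY P))
  · have hlt : rTilde s PW (cascade V (chanZ P)) Q < mutualInfo PW (cascade V (chanY P)) := by
      refine lt_of_le_of_ne (hr.trans (le_trans ?_ hsum)) fun h => hdeg ⟨h, hpos⟩
      exact_mod_cast le_add_of_nonneg_right hr₁
    -- The point `(a, 0)` satisfies both rate constraints strictly, so every point of the half-open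
    -- segment from it towards `(r₀, r₁)` does as well. This is where nondegeneracy enters.
    obtain ⟨a, ha, haI⟩ := EReal.lt_iff_exists_real_btwn.1 (max_lt hlt hpos)
    obtain ⟨har, ha0⟩ := max_lt_iff.1 ha
    have ha0' : 0 < a := by exact_mod_cast ha0
    rw [mutualInfo_eq_coe] at hsum haI
    have hsum' := EReal.coe_le_coe_iff.1 hsum
    have haI' := EReal.coe_lt_coe_iff.1 haI
    have hpath : Tendsto (fun t : ℝ => ((1 - t) * r₀ + t * a, (1 - t) * r₁)) (𝓝[>] 0)
        (𝓝 (r₀, r₁)) := by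
      have hc : Continuous fun t : ℝ => ((1 - t) * r₀ + t * a, (1 - t) * r₁) := by fun_prop
      have := (hc.tendsto 0).mono_left (nhdsWithin_le_nhds (s := Set.Ioi 0))
      simpa using this
    refine mem_closure_of_tendsto hpath ?_
    filter_upwards [Ioo_mem_nhdsGT (zero_lt_one' ℝ)] with t ht
    have ht1 : 0 < 1 - t := sub_pos.2 ht.2
    refine isAchievable_of_rTilde_lt P hQ hs (by nlinarith [mul_nonneg ht1.le hr₀, ht.1])
      (mul_nonneg ht1.le hr₁) ?_ ?_
    · rw [mutualInfo_eq_coe, EReal.coe_lt_coe_iff]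
      nlinarith [ht.1]
    -- The lower bound on the first rate is extended-real, so it is compared with the smaller of
    -- `r₀` and `a` instead of being averaged: it is at most `r₀` and strictly below `a`.
    · rcases lt_or_ge r₀ a with h | h
      · refine hr.trans_lt (EReal.coe_lt_coe_iff.2 ?_)
        nlinarith [ht.1]
      · refine har.trans_le (EReal.coe_le_coe_iff.2 ?_)
        nlinarith [ht.1]
  · have h : r₀ + r₁ ≤ 0 := by exact_mod_cast hsum.trans (not_lt.1 hpos)
    have h0 : r₀ = 0 := by linarith
    have h1 : r₁ = 0 := by linarith
    subst h0 h1
    exact subset_closure (isAchievable_zero P hQ s)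

end achievability

end Wiretap

theorem mainTheorem9 {X Y Z : Type*} [Fintype X] [Fintype Y] [Fintype Z]
    (P : X → PMF (Y × Z)) (Q : PMF Z) (s : ℝ) (hs : s ∈ Set.Icc (-1 : ℝ) 1) :
    Wiretap.virtualChannelRegion P Q s ⊆ Wiretap.admissibleRegion P Q s := by
  simp only [Wiretap.virtualChannelRegion, Set.iUnion_subset_iff]
  intro k V PW hQ hdeg
  exact Wiretap.ratePairs_subset_admissibleRegion P hQ hs hdeg
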